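/- **Setting.** A time scale is a nonempty closed subset of $\mathbb{R}$; $\int\cdots\Delta$ denotes the (Lebesgue) delta integral, $\sigma$ the forward jump operator, $\mu(t)=\sigma(t)-t$ the graininess. Let $\mathbb{T}_1,\mathbb{T}_2,\mathbb{T}_3$ be time scales, $x_0\in\mathbb{T}_1$, $y_0\in\mathbb{T}_2$, $a\le b$ in $\mathbb{T}_3$, $I=[a,b]\cap\mathbb{T}_3$ (for $\mathbb{T}_3=\mathbb{R}$, the real interval $[a,b]$), and $$H=\{(x,y,z): x\in\mathbb{T}_1,\ x\ge x_0,\ y\in\mathbb{T}_2,\ y\ge y_0,\ z\in I\}.$$ A real function on a product of time scales is rd-continuous if at every point it has a finite limit along every combination of the following approaches of the coordinates $t_i$: $t_i'\to t_i$ within the time scale if $t_i$ is right-dense; and, if $t_i$ is not right-dense, either $t_i'=t_i$ or (when $t_i$ is left-dense) $t_i'\to t_i$ strictly from the left. For one variable this is the usual notion: continuity at right-dense points and finite left limits at left-dense points. $C_{rd}$ denotes the rd-continuous functions. For $p$ with $1+\mu p>0$, $e_p(x,x_0)=\exp\int_{x_0}^x\xi_{\mu(s)}(p(s))\,\Delta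 s$, with $\xi_m(w)=\frac1m\log(1+mw)$ for $m>0$ and $\xi_0(w)=w$. **Theorem 3.3.** Let $g,v,r,f\in C_{rd}(H,\mathbb{R})$ and $F,G\in C_{rd}(H^2\times\mathbb{R},\mathbb{R})$, and suppose that $$|F(x,y,z,s,t,q,w_1)-F(x,y,z,s,t,q,w_2)|\le r(x,y,z)\,f(s,t,q)\,|w_1-w_2|$$ for all $(x,y,z),(s,t,q)\in H$ and $w_1,w_2\in\mathbb{R}$. Let $u,h\in C_{rd}(H,\mathbb{R})$ satisfy, for all $(x,y,z)\in H$, $$u(x,y,z)=g(x,y,z)+\int_{x_0}^x\!\int_{y_0}^y\!\int_a^b F(x,y,z,s,t,q,u(s,t,q))\,\Delta q\,\Delta t\,\Delta s,$$ $$h(x,y,z)=v(x,y,z)+\int_{x_0}^x\!\int_{y_0}^y\!\int_a^b G(x,y,z,s,t,q,h(s,t,q))\,\Delta q\,\Delta t\,\Delta s.$$ Then, for all $(x,y,z)\in H$, $$|u(x,y,z)-h(x,y,z)|\le \bar g(x,y,z)+\bar k(x,y,z)+r(x,y,z)\,C_4(x,y)\,e_{Q_2(\cdot,y)}(x,x_0),$$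 where $$\bar g(x,y,z)=|g(x,y,z)-v(x,y,z)|,$$ $$\bar k(x,y,z)=\int_{x_0}^x\!\int_{y_0}^y\!\int_a^b |F(x,y,z,s,t,q,h(s,t,q))-G(x,y,z,s,t,q,h(s,t,q))|\,\Delta q\,\Delta t\,\Delta s,$$ $$C_4(x,y)=\int_{x_0}^x\!\int_{y_0}^y\!\int_a^b f(s,t,q)\,[\bar g(s,t,q)+\bar k(s,t,q)]\,\Delta q\,\Delta t\,\Delta s,$$ $$Q_2(x,y)=\int_{y_0}^y\!\int_a^b f(x,t,q)\,r(x,t,q)\,\Delta q\,\Delta t .$$ -/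

import Mathlib

open Set Filter Topology MeasureTheory

noncomputable section

namespace TimeScale

/-- A time scale: a nonempty closed subset of the real line. -/
structure IsTimeScale (T : Set ℝ) : Prop where
  nonempty : T.Nonempty
  isClosed : IsClosed T

open Classical in
/-- Forward jump operator `σ(t) = inf {s ∈ T : s > t}`, with `σ(max T) = max T`. -/
def sigma (T : Set ℝ) (t : ℝ) : ℝ :=
  if (T ∩ Ioi t).Nonempty then sInf (T ∩ Ioi t) else t

/-- Graininess `μ(t) = σ(t) - t`. -/
def graininess (T : Set ℝ) (t : ℝ) : ℝ := sigma T t - t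

/-- `t` is right-dense: `t < sup T` and `σ(t) = t`. -/
def RightDense (T : Set ℝ) (t : ℝ) : Prop :=
  (T ∩ Ioi t).Nonempty ∧ sigma T t = t

/-! ### rd-continuity -/

/-- The ways of approaching `t` inside the time scale `T` that rd-continuity looks at.
If `t` is right-dense, there is one: `t' → t` in `T` from both sides, `t' = t` allowed.
If `t` is not right-dense, there are two: staying at `t`, and `t' → t` in `T` strictly from the
left (the trivial filter, which imposes no condition, when `t` is not left-dense). -/
def rdApproach (T : Set ℝ) (t : ℝ) : Set (Filter ℝ) :=
  {l | (RightDense T t ∧ l = 𝓝[T] t) ∨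
    (¬ RightDense T t ∧ (l = pure t ∨ l = 𝓝[T ∩ Iio t] t))}

/-- rd-continuity on the product `∏ i, T i` of finitely many time scales: `φ` has a finite limit
at every point along every combination of approaches of the coordinates. When all the coordinates
are right-dense this says that `φ` is continuous at the point. For one time scale it is the usual
notion, see `rdContinuous_one_iff`. -/
def RdContinuous {n : ℕ} (T : Fin n → Set ℝ) (φ : (Fin n → ℝ) → ℝ) : Prop :=
  ∀ p : Fin n → ℝ, (∀ i, p i ∈ T i) →
    ∀ l : Fin n → Filter ℝ, (∀ i, l i ∈ rdApproach (T i) (p i)) →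
      ∃ c : ℝ, Tendsto φ (Filter.pi l) (𝓝 c)

/-- On a single time scale: continuous at the right-dense points, with finite left-sided limits
at the left-dense points. -/
theorem rdContinuous_one_iff (T : Set ℝ) (φ : ℝ → ℝ) :
    RdContinuous ![T] (fun p => φ (p 0)) ↔
      (∀ t ∈ T, RightDense T t → ContinuousWithinAt φ T t) ∧
      (∀ t ∈ T, (𝓝[T ∩ Iio t] t).NeBot → ∃ c : ℝ, Tendsto φ (𝓝[T ∩ Iio t] t) (𝓝 c)) := by
  have key : ∀ (l : Filter ℝ) (c : ℝ),
      Tendsto (fun p : Fin 1 → ℝ => φ (p 0)) (Filter.pi fun _ => l) (𝓝 c) ↔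
        Tendsto φ l (𝓝 c) := by
    intro l c
    constructor
    · intro h
      have h2 : Tendsto (fun x : ℝ => (fun _ : Fin 1 => x)) l (Filter.pi fun _ => l) :=
        tendsto_pi.2 fun _ => tendsto_id
      exact h.comp h2
    · intro h
      exact h.comp (tendsto_eval_pi (fun _ : Fin 1 => l) 0)
  constructor
  · intro h
    have h' : ∀ t ∈ T, ∀ l ∈ rdApproach T t, ∃ c : ℝ, Tendsto φ l (𝓝 c) := by
      intro t ht l hl
      obtain ⟨c, hc⟩ := h (fun _ => t) (by intro i; fin_cases i; exact ht) (fun _ => l)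
        (by intro i; fin_cases i; exact hl)
      exact ⟨c, (key l c).1 hc⟩
    refine ⟨fun t ht hr => ?_, fun t ht _ => ?_⟩
    · obtain ⟨c, hc⟩ := h' t ht _ (Or.inl ⟨hr, rfl⟩)
      have h3 : Tendsto φ (pure t) (𝓝 c) := hc.mono_left (pure_le_nhdsWithin ht)
      have h4 : φ t = c := tendsto_nhds_unique (tendsto_pure_nhds φ t) h3
      rw [ContinuousWithinAt, h4]
      exact hc
    · by_cases hr : RightDense T t
      · obtain ⟨c, hc⟩ := h' t ht _ (Or.inl ⟨hr, rfl⟩)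
        exact ⟨c, hc.mono_left (nhdsWithin_mono t inter_subset_left)⟩
      · exact h' t ht _ (Or.inr ⟨hr, Or.inr rfl⟩)
  · rintro ⟨h1, h2⟩ p hp l hl
    have hl0 : l 0 ∈ rdApproach T (p 0) := hl 0
    have hp0 : p 0 ∈ T := hp 0
    have hle : l = fun _ => l 0 := by
      funext i
      rw [Subsingleton.elim i 0]
    rw [hle]
    suffices ∃ c, Tendsto φ (l 0) (𝓝 c) by
      obtain ⟨c, hc⟩ := this
      exact ⟨c, (key _ c).2 hc⟩
    rcases hl0 with ⟨hr, h⟩ | ⟨_, h | h⟩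
    · rw [h]
      exact ⟨_, h1 _ hp0 hr⟩
    · rw [h]
      exact ⟨_, tendsto_pure_nhds φ (p 0)⟩
    · rw [h]
      by_cases hb : (𝓝[T ∩ Iio (p 0)] (p 0)).NeBot
      · exact h2 _ hp0 hb
      · rw [Filter.not_neBot.1 hb]
        exact ⟨0, tendsto_bot⟩

/-! ### The delta integral -/

/-- The last point of `T` at or before `x`. -/
def lastPoint (T : Set ℝ) (x : ℝ) : ℝ := sSup (T ∩ Iic x)

/-- The real numbers `x` that have a point of `T` at or below them and a point of `T` above them. -/
def hull (T : Set ℝ) : Set ℝ := {x | (T ∩ Iic x).Nonempty ∧ (T ∩ Ioi x).Nonempty}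

/-- The Lebesgue delta measure of a time scale `T`: it is carried by `T` and gives the time scale
interval `[c, d) ∩ T` with `c, d ∈ T` the mass `d - c` (see `deltaMeasure_Ico`). It is the image
of Lebesgue measure under the map that collapses every gap `[t, σ(t))` to the point `t`. -/
def deltaMeasure (T : Set ℝ) : Measure ℝ :=
  Measure.map (lastPoint T) (volume.restrict (hull T))

theorem measurableSet_hull (T : Set ℝ) : MeasurableSet (hull T) := by
  have : OrdConnected (hull T) := by
    refine ⟨fun x hx y hy w hw => ⟨?_, ?_⟩⟩
    · obtain ⟨s, hs, hsx⟩ := hx.1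
      exact ⟨s, hs, le_trans hsx hw.1⟩
    · obtain ⟨s, hs, hsy⟩ := hy.2
      exact ⟨s, hs, lt_of_le_of_lt hw.2 hsy⟩
  exact this.measurableSet

theorem aemeasurable_lastPoint (T : Set ℝ) :
    AEMeasurable (lastPoint T) (volume.restrict (hull T)) := by
  refine aemeasurable_restrict_of_monotoneOn (measurableSet_hull T) ?_
  intro x hx y _ hxy
  exact csSup_le_csSup ⟨y, fun s hs => hs.2⟩ hx.1 fun s hs => ⟨hs.1, le_trans hs.2 hxy⟩

theorem deltaMeasure_Ico {T : Set ℝ} {c d : ℝ} (hc : c ∈ T) (hd : d ∈ T) :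
    deltaMeasure T (Ico c d) = ENNReal.ofReal (d - c) := by
  have hpre : lastPoint T ⁻¹' Ico c d ∩ hull T = Ico c d := by
    ext x
    constructor
    · rintro ⟨⟨h1, h2⟩, hx, _⟩
      have hbdd : BddAbove (T ∩ Iic x) := ⟨x, fun s hs => hs.2⟩
      refine ⟨le_trans h1 (csSup_le hx fun s hs => hs.2), ?_⟩
      by_contra hcon
      exact absurd (le_csSup hbdd ⟨hd, not_lt.1 hcon⟩) (not_le.2 h2)
    · rintro ⟨h1, h2⟩
      have hbdd : BddAbove (T ∩ Iic x) := ⟨x, fun s hs => hs.2⟩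
      have hne : (T ∩ Iic x).Nonempty := ⟨c, hc, h1⟩
      exact ⟨⟨le_csSup hbdd ⟨hc, h1⟩, lt_of_le_of_lt (csSup_le hne fun s hs => hs.2) h2⟩,
        hne, ⟨d, hd, h2⟩⟩
  rw [deltaMeasure, Measure.map_apply_of_aemeasurable (aemeasurable_lastPoint T) measurableSet_Ico,
    Measure.restrict_apply' (measurableSet_hull T), hpre, Real.volume_Ico]

/-- The delta integral `∫_c^d φ(t) Δt`: the integral over `[c, d) ∩ T` against the delta measure,
with the sign changed when `d < c`. -/
def deltaIntegral (T : Set ℝ) (c d : ℝ) (φ : ℝ → ℝ) : ℝ :=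
  (∫ t in Ico c d, φ t ∂(deltaMeasure T)) - ∫ t in Ico d c, φ t ∂(deltaMeasure T)

/-! ### The exponential function -/

/-- Cylinder transformation `ξ_m(w) = log (1 + m w) / m` for `m > 0`, and `ξ_0(w) = w`
(here for `1 + m w > 0`, where the logarithm is real). -/
def cylinder (m w : ℝ) : ℝ := if m = 0 then w else Real.log (1 + m * w) / m

/-- The exponential function `e_p(t, s) = exp (∫_s^t ξ_{μ(τ)}(p(τ)) Δτ)` of a time scale, for
positively regressive `p`, that is `1 + μ p > 0`. -/
def deltaExp (T : Set ℝ) (p : ℝ → ℝ) (t s : ℝ) : ℝ :=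
  Real.exp (deltaIntegral T s t fun τ => cylinder (graininess T τ) (p τ))

/-! ### Integral equations in three variables -/

/-- Three time scales, the base points `x₀`, `y₀`, and the end points of the interval
`I = [a, b] ∩ T₃`; for `T₃ = ℝ` this is the real interval `[a, b]`. -/
structure Domain where
  T₁ : Set ℝ
  T₂ : Set ℝ
  T₃ : Set ℝ
  x₀ : ℝ
  y₀ : ℝ
  a : ℝ
  b : ℝ
  isTimeScale₁ : IsTimeScale T₁
  isTimeScale₂ : IsTimeScale T₂
  isTimeScale₃ : IsTimeScale T₃
  x₀_mem : x₀ ∈ T₁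
  y₀_mem : y₀ ∈ T₂
  a_mem : a ∈ T₃
  b_mem : b ∈ T₃
  a_le_b : a ≤ b

namespace Domain

variable (D : Domain)

/-- The set `H`: the points `(x, y, z)` with `x ∈ T₁`, `x ≥ x₀`, `y ∈ T₂`, `y ≥ y₀`, `z ∈ I`. -/
def Mem (x y z : ℝ) : Prop :=
  x ∈ D.T₁ ∩ Ici D.x₀ ∧ y ∈ D.T₂ ∩ Ici D.y₀ ∧ z ∈ D.T₃ ∩ Icc D.a D.b

/-- `C_rd(H, ℝ)`. -/
def Crd (φ : ℝ → ℝ → ℝ → ℝ) : Prop :=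
  RdContinuous ![D.T₁ ∩ Ici D.x₀, D.T₂ ∩ Ici D.y₀, D.T₃ ∩ Icc D.a D.b]
    (fun p => φ (p 0) (p 1) (p 2))

/-- `C_rd(H² × ℝ, ℝ)`, with arguments `(x, y, z, s, t, q, w)`. -/
def CrdKernel (Φ : ℝ → ℝ → ℝ → ℝ → ℝ → ℝ → ℝ → ℝ) : Prop :=
  RdContinuous ![D.T₁ ∩ Ici D.x₀, D.T₂ ∩ Ici D.y₀, D.T₃ ∩ Icc D.a D.b,
      D.T₁ ∩ Ici D.x₀, D.T₂ ∩ Ici D.y₀, D.T₃ ∩ Icc D.a D.b, univ]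
    (fun p => Φ (p 0) (p 1) (p 2) (p 3) (p 4) (p 5) (p 6))

/-- `∫_{x₀}^x ∫_{y₀}^y ∫_a^b φ(s, t, q) Δq Δt Δs`. -/
def tripleIntegral (x y : ℝ) (φ : ℝ → ℝ → ℝ → ℝ) : ℝ :=
  deltaIntegral D.T₁ D.x₀ x fun s => deltaIntegral D.T₂ D.y₀ y fun t =>
    deltaIntegral D.T₃ D.a D.b fun q => φ s t q

/-- `u ∈ C_rd(H, ℝ)` solves
`u(x,y,z) = g(x,y,z) + ∫_{x₀}^x ∫_{y₀}^y ∫_a^b F(x,y,z,s,t,q,u(s,t,q)) Δq Δt Δs` on `H`. -/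
def IsSolution (g : ℝ → ℝ → ℝ → ℝ) (F : ℝ → ℝ → ℝ → ℝ → ℝ → ℝ → ℝ → ℝ)
    (u : ℝ → ℝ → ℝ → ℝ) : Prop :=
  D.Crd u ∧ ∀ x y z, D.Mem x y z →
    u x y z = g x y z + D.tripleIntegral x y fun s t q => F x y z s t q (u s t q)

/-- `|F(x,y,z,s,t,q,w₁) - F(x,y,z,s,t,q,w₂)| ≤ r(x,y,z) f(s,t,q) |w₁ - w₂|` on `H² × ℝ²`. -/
def LipschitzCondition (F : ℝ → ℝ → ℝ → ℝ → ℝ → ℝ → ℝ → ℝ) (r f : ℝ → ℝ → ℝ → ℝ) : Prop :=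
  ∀ x y z s t q w₁ w₂, D.Mem x y z → D.Mem s t q →
    |F x y z s t q w₁ - F x y z s t q w₂| ≤ r x y z * f s t q * |w₁ - w₂|

/-- `Q₂(x,y) = ∫_{y₀}^y ∫_a^b f(x,t,q) r(x,t,q) Δq Δt`. -/
def Q₂ (r f : ℝ → ℝ → ℝ → ℝ) (x y : ℝ) : ℝ :=
  deltaIntegral D.T₂ D.y₀ y fun t => deltaIntegral D.T₃ D.a D.b fun q => f x t q * r x t q

/-- `ḡ = |g - v|`. -/
def gBar (g v : ℝ → ℝ → ℝ → ℝ) (x y z : ℝ) : ℝ := |g x y z - v x y z|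

/-- `k̄(x,y,z) = ∫∫∫ |F(x,y,z,s,t,q,h(s,t,q)) - G(x,y,z,s,t,q,h(s,t,q))| Δq Δt Δs`. -/
def kBar (F G : ℝ → ℝ → ℝ → ℝ → ℝ → ℝ → ℝ → ℝ) (h : ℝ → ℝ → ℝ → ℝ) (x y z : ℝ) : ℝ :=
  D.tripleIntegral x y fun s t q => |F x y z s t q (h s t q) - G x y z s t q (h s t q)|

/-- `C₄(x,y) = ∫∫∫ f(s,t,q) [ḡ(s,t,q) + k̄(s,t,q)] Δq Δt Δs`. -/
def C₄ (f g v : ℝ → ℝ → ℝ → ℝ) (F G : ℝ → ℝ → ℝ → ℝ → ℝ → ℝ → ℝ → ℝ)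
    (h : ℝ → ℝ → ℝ → ℝ) (x y : ℝ) : ℝ :=
  D.tripleIntegral x y fun s t q => f s t q * (gBar g v s t q + D.kBar F G h s t q)

end Domain

end TimeScale

end

/-!
Subtracting the two equations and inserting `F(p, p', h(p'))`, the Lipschitz condition gives
`w ≤ A + r ∫∫∫ f w` for `w = |u - h|` and `A = ḡ + k̄`. Put `Φ(x, y) = ∫_{x₀}^x ∫_{y₀}^y ∫_a^b f w`.
As `Φ` is monotone in `y`, it satisfies `Φ(x, Y) ≤ C₄(X, Y) + ∫_{x₀}^x Q₂(s, Y) Φ(s, Y) Δs` for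
`x ≤ X`, and Grönwall's inequality in the first variable (`gronwall`) bounds `Φ(X, Y)` by
`C₄(X, Y) e_{Q₂(·, Y)}(X, x₀)`; this is `Domain.le_of_le_add_mul_integral`. The functions `r` and
`f` need not be nonnegative, but the Lipschitz condition makes every product
`r(x, y, z) f(s, t, q)` nonnegative and only such products matter, so that `|r|` and `|f|` can take
their place.

Grönwall's inequality is proved by passing to Lebesgue measure, of which the delta measure is the
image under `lastPoint T`. The majorant becomes an absolutely continuous function of a real
variable, and the logarithmic derivative of that function is at most `interpRate T p` almost
everywhere. The integral of `interpRate T p` equals that of the cylinder transformation of `p`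
(`integral_interpRate`), because the two agree on `T` up to a countable set and have the same
integral over each gap.

All the integrals involved have to exist. The points that are not right-dense are countable in each
coordinate, so an rd-continuous function on closed sets is continuous on each of countably many
Borel pieces, hence Borel measurable (`measurable_indicator_of_rdContinuous`); and it is bounded on
compact sets (`exists_bound_of_rdContinuous`). Extended by zero, such functions fall into the class
`Domain.Regular`, on which iterated delta integrals are integrals over a product measure.
-/

noncomputable section

namespace TimeScale

/-! ### Measurability and boundedness of rd-continuous functions -/

theorem exists_gap_of_not_rightDense {T : Set ℝ} {t : ℝ} (h : ¬ RightDense T t) :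
    ∃ d, t < d ∧ ∀ s ∈ T, t < s → d ≤ s := by
  by_cases hne : (T ∩ Ioi t).Nonempty
  · have hle : t ≤ sInf (T ∩ Ioi t) := le_csInf hne fun s hs => le_of_lt hs.2
    have hσ : sigma T t = sInf (T ∩ Ioi t) := if_pos hne
    refine ⟨sInf (T ∩ Ioi t), lt_of_le_of_ne hle fun he => h ⟨hne, by rw [hσ, ← he]⟩, ?_⟩
    exact fun s hs hts => csInf_le ⟨t, fun r hr => le_of_lt hr.2⟩ ⟨hs, hts⟩
  · exact ⟨t + 1, by linarith, fun s hs hts => absurd ⟨s, hs, hts⟩ hne⟩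

theorem countable_not_rightDense (T : Set ℝ) : {t ∈ T | ¬ RightDense T t}.Countable := by
  refine (countable_setOfPred_isolated_right_within (s := T)).mono ?_
  rintro t ⟨ht, hr⟩
  refine ⟨ht, ?_⟩
  obtain ⟨d, htd, hd⟩ := exists_gap_of_not_rightDense hr
  rw [← empty_mem_iff_bot]
  filter_upwards [self_mem_nhdsWithin, mem_nhdsWithin_of_mem_nhds (Iio_mem_nhds htd)] with s hs hsd
  exact absurd hsd (not_lt.2 (hd s hs.1 hs.2))

/-- Near a point that is not right-dense a time scale has no points on the right, so the two
approaches considered in rd-continuity exhaust the neighbourhood filter. -/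
theorem nhdsWithin_le_of_not_rightDense {T : Set ℝ} {t : ℝ} (h : ¬ RightDense T t) :
    𝓝[T] t ≤ pure t ⊔ 𝓝[T ∩ Iio t] t := by
  obtain ⟨d, htd, hd⟩ := exists_gap_of_not_rightDense h
  intro S hS
  rw [mem_sup, mem_pure] at hS
  obtain ⟨htS, hS⟩ := hS
  rw [mem_nhdsWithin_iff_eventually] at hS
  filter_upwards [self_mem_nhdsWithin, mem_nhdsWithin_of_mem_nhds (Iio_mem_nhds htd),
    mem_nhdsWithin_of_mem_nhds hS] with s hs hsd hsS
  rcases lt_trichotomy s t with hst | rfl | hts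
  · exact hsS ⟨hs, hst⟩
  · exact htS
  · exact absurd hsd (not_lt.2 (hd s hs hts))

variable {n : ℕ} {T : Fin n → Set ℝ} {φ : (Fin n → ℝ) → ℝ}

theorem measurable_indicator_of_rdContinuous (hT : ∀ i, IsClosed (T i)) (hφ : RdContinuous T φ) :
    Measurable ((univ.pi T).indicator φ) := by
  classical
  -- The pieces on which the coordinates that are not right-dense are prescribed, `none` standing
  -- for a right-dense coordinate. There are countably many, and `φ` is continuous on each.
  let N : Fin n → Set ℝ := fun i => {t ∈ T i | ¬ RightDense (T i) t}
  have hN : ∀ i, (N i).Countable := fun i => countable_not_rightDense (T i)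
  have : ∀ i, Countable (N i) := fun i => (hN i).to_subtype
  let Q : ∀ i, Option (N i) → Set ℝ := fun i o => o.elim (T i \ N i) fun t => {(t : ℝ)}
  let P : (∀ i, Option (N i)) → Fin n → Set ℝ := fun c i => Q i (c i)
  have hPm : ∀ c, MeasurableSet (univ.pi (P c)) := by
    refine fun c => MeasurableSet.univ_pi fun i => ?_
    have : ∀ o, MeasurableSet (Q i o) := by
      rintro (_ | t)
      · exact (hT i).measurableSet.diff (hN i).measurableSet
      · exact measurableSet_singleton _
    exact this (c i)
  have hPT : ∀ c i x, x ∈ P c i → x ∈ T i := by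
    intro c i x
    have : ∀ o, x ∈ Q i o → x ∈ T i := by
      rintro (_ | t) hx
      · exact hx.1
      · exact (show x = t from hx) ▸ t.2.1
    exact this (c i)
  have hPN : ∀ c i, ∀ x ∈ N i, x ∈ P c i → P c i = {x} := by
    intro c i x hxN
    have : ∀ o, x ∈ Q i o → Q i o = {x} := by
      rintro (_ | t) hx
      · exact absurd hxN hx.2
      · rw [show x = t from hx]
        rfl
    exact this (c i)
  have hcont : ∀ c, ContinuousOn φ (univ.pi (P c)) := by
    intro c p hp
    have hl : ∀ i, ∃ l ∈ rdApproach (T i) (p i), 𝓝[P c i] (p i) ≤ l ∧ pure (p i) ≤ l := by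
      intro i
      have hpi := hp i (mem_univ i)
      have hpT := hPT c i _ hpi
      by_cases hr : RightDense (T i) (p i)
      · exact ⟨_, Or.inl ⟨hr, rfl⟩, nhdsWithin_mono _ (hPT c i), pure_le_nhdsWithin hpT⟩
      · refine ⟨_, Or.inr ⟨hr, Or.inl rfl⟩, ?_, le_rfl⟩
        rw [hPN c i _ ⟨hpT, hr⟩ hpi, nhdsWithin_singleton]
    choose l hlmem hlP hlp using hl
    obtain ⟨a, ha⟩ := hφ p (fun i => hPT c i _ (hp i (mem_univ i))) l hlmem
    have h1 : 𝓝[univ.pi (P c)] p ≤ Filter.pi l := by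
      refine tendsto_id'.1 (tendsto_pi.2 fun i => ?_)
      refine le_trans ?_ (hlP i)
      exact tendsto_nhdsWithin_of_tendsto_nhds_of_eventually_within _
        ((continuous_apply i).continuousAt.mono_left nhdsWithin_le_nhds)
        (eventually_mem_nhdsWithin.mono fun q hq => hq i (mem_univ i))
    have h2 : φ p = a := by
      have h3 : pure p ≤ Filter.pi l := (pure_le_nhdsWithin hp).trans h1
      exact tendsto_nhds_unique (tendsto_pure_nhds φ p) (ha.mono_left h3)
    rw [ContinuousWithinAt, h2]
    exact ha.mono_left h1
  have hcover : univ.pi T = ⋃ c, univ.pi (P c) := by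
    refine subset_antisymm ?_ (iUnion_subset fun c p hp i hi => hPT c i _ (hp i hi))
    intro p hp
    refine mem_iUnion.2 ⟨fun i => if h : p i ∈ N i then some ⟨p i, h⟩ else none, fun i hi => ?_⟩
    by_cases h : p i ∈ N i
    · simp [P, Q, h]
    · simpa [P, Q, h] using hp i hi
  have hpiece : ∀ c, Measurable ((univ.pi (P c)).indicator φ) := by
    intro c
    have := (hcont c).measurable_piecewise (g := fun _ => (0 : ℝ)) continuousOn_const (hPm c)
    rwa [show (fun _ => (0 : ℝ)) = (0 : (Fin n → ℝ) → ℝ) from rfl, piecewise_eq_indicator] at this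
  refine measurable_of_restrict_of_restrict_compl (s := univ.pi T)
    (MeasurableSet.univ_pi fun i => (hT i).measurableSet) ?_ ?_
  · intro B hB
    refine ⟨⋃ c, univ.pi (P c) ∩ (univ.pi (P c)).indicator φ ⁻¹' B,
      MeasurableSet.iUnion fun c => (hPm c).inter (hpiece c hB), ?_⟩
    ext ⟨p, hp⟩
    have hp' := hp
    rw [hcover, mem_iUnion] at hp'
    simp only [mem_preimage, mem_iUnion, mem_inter_iff, domRestrict_apply, indicator_of_mem hp]
    constructor
    · rintro ⟨c, hc, hB'⟩
      rwa [indicator_of_mem hc] at hB'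
    · intro hB'
      obtain ⟨c, hc⟩ := hp'
      exact ⟨c, hc, by rwa [indicator_of_mem hc]⟩
  · have : ((univ.pi T)ᶜ).domRestrict ((univ.pi T).indicator φ) = fun _ => 0 := by
      funext p
      exact indicator_of_notMem p.2 φ
    rw [this]
    exact measurable_const

/-- An ultrafilter on a compact set converges along one of the combinations of approaches, so an
rd-continuous function cannot be unbounded along it. -/
theorem exists_bound_of_rdContinuous (hφ : RdContinuous T φ) {K : Set (Fin n → ℝ)}
    (hK : IsCompact K) (hKT : K ⊆ univ.pi T) : ∃ M, ∀ p ∈ K, |φ p| ≤ M := by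
  by_contra! hcon
  have hne : (comap (fun p => |φ p|) atTop ⊓ 𝓟 K).NeBot := by
    rw [inf_principal_neBot_iff]
    intro U hU
    obtain ⟨V, hV, hVU⟩ := mem_comap.1 hU
    obtain ⟨M, hM⟩ := mem_atTop_sets.1 hV
    obtain ⟨p, hp, hMp⟩ := hcon M
    exact ⟨p, hVU (hM _ hMp.le), hp⟩
  let 𝒰 := Ultrafilter.of (comap (fun p => |φ p|) atTop ⊓ 𝓟 K)
  have h𝒰 : (𝒰 : Filter (Fin n → ℝ)) ≤ comap (fun p => |φ p|) atTop ⊓ 𝓟 K := Ultrafilter.of_le _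
  obtain ⟨p, hpK, hp⟩ := hK.ultrafilter_le_nhds 𝒰 (h𝒰.trans inf_le_right)
  have hpT := hKT hpK
  have hl : ∀ i, ∃ l ∈ rdApproach (T i) (p i), (𝒰.map fun q => q i : Filter ℝ) ≤ l := by
    intro i
    have h1 : (𝒰.map fun q => q i : Filter ℝ) ≤ 𝓝[T i] (p i) := by
      refine tendsto_nhdsWithin_of_tendsto_nhds_of_eventually_within _
        ((continuous_apply i).continuousAt.mono_left hp) ?_
      filter_upwards [h𝒰.trans inf_le_right (mem_principal_self K)] with q hq
      exact hKT hq i (mem_univ i)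
    by_cases hr : RightDense (T i) (p i)
    · exact ⟨_, Or.inl ⟨hr, rfl⟩, h1⟩
    · rcases Ultrafilter.le_sup_iff.1 (h1.trans (nhdsWithin_le_of_not_rightDense hr)) with h | h
      · exact ⟨_, Or.inr ⟨hr, Or.inl rfl⟩, h⟩
      · exact ⟨_, Or.inr ⟨hr, Or.inr rfl⟩, h⟩
  choose l hlmem hl𝒰 using hl
  obtain ⟨a, ha⟩ := hφ p (fun i => hpT i (mem_univ i)) l hlmem
  have h1 : Tendsto (fun q => |φ q|) 𝒰 (𝓝 |a|) :=
    (ha.mono_left (tendsto_id'.1 (tendsto_pi.2 hl𝒰))).abs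
  have h2 : Tendsto (fun q => |φ q|) 𝒰 atTop := tendsto_comap.mono_left (h𝒰.trans inf_le_left)
  exact not_tendsto_nhds_of_tendsto_atTop h2 _ h1

/-! ### The delta measure as an image of Lebesgue measure -/

section LastPoint

variable {T : Set ℝ} {c d x : ℝ}

theorem le_lastPoint (hc : c ∈ T) (hcx : c ≤ x) : c ≤ lastPoint T x :=
  le_csSup ⟨x, fun _ hs => hs.2⟩ ⟨hc, hcx⟩

theorem lastPoint_le (hc : c ∈ T) (hcx : c ≤ x) : lastPoint T x ≤ x :=
  csSup_le ⟨c, hc, hcx⟩ fun _ hs => hs.2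

theorem lastPoint_of_mem (hx : x ∈ T) : lastPoint T x = x :=
  le_antisymm (lastPoint_le hx le_rfl) (le_lastPoint hx le_rfl)

theorem lastPoint_mem (hT : IsClosed T) (hc : c ∈ T) (hcx : c ≤ x) : lastPoint T x ∈ T :=
  ((hT.inter isClosed_Iic).csSup_mem ⟨c, hc, hcx⟩ ⟨x, fun _ hs => hs.2⟩).1

theorem lastPoint_eq_of_gap (hc : c ∈ T) (hcx : c ≤ x) (h : ∀ s ∈ T, c < s → x < s) :
    lastPoint T x = c := by
  refine le_antisymm (csSup_le ⟨c, hc, hcx⟩ fun s hs => ?_) (le_lastPoint hc hcx)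
  by_contra! hcs
  exact absurd hs.2 (not_le.2 (h s hs.1 hcs))

theorem aemeasurable_lastPoint_Icc (hc : c ∈ T) :
    AEMeasurable (lastPoint T) (volume.restrict (Icc c d)) := by
  refine aemeasurable_restrict_of_monotoneOn measurableSet_Icc ?_
  intro x hx y _ hxy
  exact csSup_le_csSup ⟨y, fun s hs => hs.2⟩ ⟨c, hc, hx.1⟩ fun s hs => ⟨hs.1, le_trans hs.2 hxy⟩

theorem ae_mem_deltaMeasure (hT : IsClosed T) : ∀ᵐ t ∂deltaMeasure T, t ∈ T := by
  refine (ae_map_iff (aemeasurable_lastPoint T) hT.measurableSet).2 ?_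
  filter_upwards [ae_restrict_mem (measurableSet_hull T)] with s hs
  obtain ⟨t, ht, hts⟩ := hs.1
  exact lastPoint_mem hT ht hts

theorem setIntegral_deltaMeasure_Ico (hc : c ∈ T) (hd : d ∈ T) {φ : ℝ → ℝ} (hφ : Measurable φ) :
    ∫ t in Ico c d, φ t ∂deltaMeasure T = ∫ s in Ico c d, φ (lastPoint T s) := by
  have hpre : lastPoint T ⁻¹' Ico c d ∩ hull T = Ico c d := by
    ext x
    constructor
    · rintro ⟨⟨h1, h2⟩, ⟨s, hs, hsx⟩, _⟩
      refine ⟨h1.trans (lastPoint_le hs hsx), ?_⟩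
      by_contra! hdx
      exact absurd (le_lastPoint hd hdx) (not_le.2 h2)
    · rintro ⟨h1, h2⟩
      exact ⟨⟨le_lastPoint hc h1, (lastPoint_le hc h1).trans_lt h2⟩, ⟨c, hc, h1⟩, ⟨d, hd, h2⟩⟩
  rw [deltaMeasure, setIntegral_map measurableSet_Ico hφ.aestronglyMeasurable
    (aemeasurable_lastPoint T), Measure.restrict_restrict₀', hpre]
  exact (measurableSet_hull T).nullMeasurableSet

theorem sigma_mono (T : Set ℝ) : Monotone (sigma T) := by
  intro t t' h
  have hsub : T ∩ Ioi t' ⊆ T ∩ Ioi t := fun s hs => ⟨hs.1, lt_of_le_of_lt h hs.2⟩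
  unfold sigma
  split_ifs with h1 h2 h2
  · exact csInf_le_csInf ⟨t, fun s hs => le_of_lt hs.2⟩ h2 hsub
  · obtain ⟨s, hs⟩ := h1
    refine (csInf_le ⟨t, fun r hr => le_of_lt hr.2⟩ hs).trans ?_
    by_contra! hlt
    exact h2 ⟨s, hs.1, hlt⟩
  · exact absurd (h2.mono hsub) h1
  · exact h

theorem measurable_graininess (T : Set ℝ) : Measurable (graininess T) :=
  (sigma_mono T).measurable.sub measurable_id

theorem sigma_le (hd : d ∈ T) (hcd : c < d) : sigma T c ≤ d := by
  rw [sigma, if_pos ⟨d, hd, hcd⟩]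
  exact csInf_le ⟨c, fun r hr => le_of_lt hr.2⟩ ⟨hd, hcd⟩

theorem sigma_mem (hT : IsClosed T) (hc : c ∈ T) : sigma T c ∈ T := by
  unfold sigma
  split_ifs with h
  · have hσ : sInf (T ∩ Ioi c) ∈ closure (T ∩ Ioi c) :=
      csInf_mem_closure h ⟨c, fun r hr => le_of_lt hr.2⟩
    exact hT.closure_subset (closure_mono inter_subset_left hσ)
  · exact hc

theorem le_sigma (T : Set ℝ) (c : ℝ) : c ≤ sigma T c := by
  unfold sigma
  split_ifs with h
  · exact le_csInf h fun s hs => le_of_lt hs.2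
  · exact le_rfl

theorem graininess_nonneg (T : Set ℝ) (t : ℝ) : 0 ≤ graininess T t :=
  sub_nonneg.2 (le_sigma T t)

end LastPoint

/-! ### The cylinder transformation and gaps -/

theorem cylinder_nonneg {m w : ℝ} (hm : 0 ≤ m) (hw : 0 ≤ w) : 0 ≤ cylinder m w := by
  unfold cylinder
  split_ifs
  · exact hw
  · exact div_nonneg (Real.log_nonneg (by nlinarith [mul_nonneg hm hw])) hm

theorem cylinder_le {m w : ℝ} (hm : 0 ≤ m) (hw : 0 ≤ w) : cylinder m w ≤ w := by
  unfold cylinder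
  split_ifs with h
  · exact le_rfl
  · have hm' : 0 < m := lt_of_le_of_ne hm (Ne.symm h)
    rw [div_le_iff₀ hm']
    have := Real.log_le_sub_one_of_pos (show 0 < 1 + m * w by nlinarith [mul_nonneg hm hw])
    linarith

theorem measurable_cylinder {m w : ℝ → ℝ} (hm : Measurable m) (hw : Measurable w) :
    Measurable fun t => cylinder (m t) (w t) := by
  unfold cylinder
  exact Measurable.ite (hm (measurableSet_singleton 0)) hw
    ((Real.measurable_log.comp (measurable_const.add (hm.mul hw))).div hm)

/-- The logarithmic derivative, at the real number `s`, of the function that interpolates the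
exponential function of `T` linearly across the gaps of `T`. -/
def interpRate (T : Set ℝ) (p : ℝ → ℝ) (s : ℝ) : ℝ :=
  p (lastPoint T s) / (1 + p (lastPoint T s) * (s - lastPoint T s))

section Gap

variable {T : Set ℝ} {c d M : ℝ} {p : ℝ → ℝ}

theorem integral_gap {t e w : ℝ} (hte : t < e) (hw : 0 ≤ w) :
    ∫ s in Ioo t e, (w / (1 + w * (s - t)) - cylinder (e - t) w) = 0 := by
  have hpos : ∀ s ∈ uIcc t e, 0 < 1 + w * (s - t) := by
    intro s hs
    rw [uIcc_of_le hte.le] at hs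
    nlinarith [mul_nonneg hw (sub_nonneg.2 hs.1)]
  have hder : ∀ s ∈ uIcc t e, HasDerivAt (fun s => Real.log (1 + w * (s - t)))
      (w / (1 + w * (s - t))) s := by
    intro s hs
    have h1 : HasDerivAt (fun s => 1 + w * (s - t)) w s := by
      simpa using (((hasDerivAt_id s).sub_const t).const_mul w).const_add 1
    exact h1.log (hpos s hs).ne'
  have hcont : ContinuousOn (fun s => w / (1 + w * (s - t))) (uIcc t e) :=
    continuousOn_const.div (by fun_prop) fun s hs => (hpos s hs).ne'
  have hne : e - t ≠ 0 := (sub_pos.2 hte).ne'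
  rw [← integral_Ioc_eq_integral_Ioo, ← intervalIntegral.integral_of_le hte.le,
    intervalIntegral.integral_sub hcont.intervalIntegrable intervalIntegrable_const,
    intervalIntegral.integral_eq_sub_of_hasDerivAt hder hcont.intervalIntegrable,
    intervalIntegral.integral_const, cylinder, if_neg hne, smul_eq_mul]
  field_simp
  simp

theorem diff_eq_iUnion_gaps (hT : IsClosed T) (hc : c ∈ T) (hd : d ∈ T) :
    Ico c d \ T = ⋃ t : ↥({t ∈ T | ¬ RightDense T t} ∩ Ico c d), Ioo (t : ℝ) (sigma T t) := by
  ext s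
  simp only [mem_iUnion]
  constructor
  · rintro ⟨⟨hcs, hsd⟩, hsT⟩
    have hm := lastPoint_mem hT hc hcs
    have hle := lastPoint_le hc hcs
    have hlt : lastPoint T s < s := lt_of_le_of_ne hle fun h => hsT (h ▸ hm)
    have hgap : s < sigma T (lastPoint T s) := by
      have hne : (T ∩ Ioi (lastPoint T s)).Nonempty := ⟨d, hd, hle.trans_lt hsd⟩
      have hsσ : s ≤ sigma T (lastPoint T s) := by
        rw [sigma, if_pos hne]
        refine le_csInf hne fun r hr => ?_
        by_contra! hrs
        exact absurd (le_lastPoint hr.1 hrs.le) (not_le.2 hr.2)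
      exact lt_of_le_of_ne hsσ fun h => hsT (h ▸ sigma_mem hT hm)
    exact ⟨⟨lastPoint T s, ⟨hm, fun hr => (hlt.trans hgap).ne' hr.2⟩,
      le_lastPoint hc hcs, hle.trans_lt hsd⟩, hlt, hgap⟩
  · rintro ⟨⟨t, ⟨ht, _⟩, hct, htd⟩, hts, hsσ⟩
    refine ⟨⟨hct.trans hts.le, hsσ.trans_le (sigma_le hd htd)⟩, fun hsT => ?_⟩
    exact absurd (sigma_le hsT hts) (not_le.2 hsσ)

theorem interpRate_bounds (hc : c ∈ T) (hp0 : ∀ t, 0 ≤ p t) (hpM : ∀ t ∈ Icc c d, p t ≤ M)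
    {s : ℝ} (hs : s ∈ Icc c d) : 0 ≤ interpRate T p s ∧ interpRate T p s ≤ M := by
  have h1 : 0 ≤ p (lastPoint T s) * (s - lastPoint T s) :=
    mul_nonneg (hp0 _) (sub_nonneg.2 (lastPoint_le hc hs.1))
  refine ⟨div_nonneg (hp0 _) (by linarith), (div_le_self (hp0 _) (by linarith)).trans ?_⟩
  exact hpM _ ⟨le_lastPoint hc hs.1, (lastPoint_le hc hs.1).trans hs.2⟩

theorem integrableOn_interpRate (hc : c ∈ T) (hp : Measurable p) (hp0 : ∀ t, 0 ≤ p t)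
    (hpM : ∀ t ∈ Icc c d, p t ≤ M) : IntegrableOn (interpRate T p) (Icc c d) := by
  have hρ := aemeasurable_lastPoint_Icc (T := T) (d := d) hc
  have hpρ : AEMeasurable (fun s => p (lastPoint T s)) (volume.restrict (Icc c d)) :=
    hp.comp_aemeasurable hρ
  refine Integrable.of_bound
    (hpρ.div (aemeasurable_const.add (hpρ.mul (aemeasurable_id.sub hρ)))).aestronglyMeasurable M ?_
  filter_upwards [ae_restrict_mem measurableSet_Icc] with s hs
  have := interpRate_bounds hc hp0 hpM hs
  rw [Real.norm_eq_abs, abs_of_nonneg this.1]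
  exact this.2

/-- On a gap `[t, σ(t))` the two integrands have the same integral `log (1 + μ(t) p(t))`, and at
almost all points of `T` they agree, the points that are not right-dense being countable. -/
theorem integral_interpRate (hT : IsClosed T) (hc : c ∈ T) (hd : d ∈ T) (hp : Measurable p)
    (hp0 : ∀ t, 0 ≤ p t) (hpM : ∀ t ∈ Icc c d, p t ≤ M) :
    ∫ s in Ico c d, interpRate T p s =
      ∫ t in Ico c d, cylinder (graininess T t) (p t) ∂deltaMeasure T := by
  have hcyl := measurable_cylinder (measurable_graininess T) hp
  rw [setIntegral_deltaMeasure_Ico hc hd hcyl]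
  have hi1 : IntegrableOn (interpRate T p) (Ico c d) :=
    (integrableOn_interpRate hc hp hp0 hpM).mono_set Ico_subset_Icc_self
  have hi2 : IntegrableOn (fun s => cylinder (graininess T (lastPoint T s)) (p (lastPoint T s)))
      (Ico c d) := by
    refine IntegrableOn.mono_set (t := Icc c d) ?_ Ico_subset_Icc_self
    refine Integrable.of_bound
      (hcyl.comp_aemeasurable (aemeasurable_lastPoint_Icc hc)).aestronglyMeasurable M ?_
    filter_upwards [ae_restrict_mem measurableSet_Icc] with s hs
    rw [Real.norm_eq_abs, abs_of_nonneg (cylinder_nonneg (graininess_nonneg _ _) (hp0 _))]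
    exact (cylinder_le (graininess_nonneg _ _) (hp0 _)).trans
      (hpM _ ⟨le_lastPoint hc hs.1, (lastPoint_le hc hs.1).trans hs.2⟩)
  have hi : IntegrableOn (fun s => interpRate T p s -
      cylinder (graininess T (lastPoint T s)) (p (lastPoint T s))) (Ico c d) := hi1.sub hi2
  rw [← sub_eq_zero, ← integral_sub hi1 hi2, ← integral_inter_add_sdiff hT.measurableSet hi]
  have h1 : ∫ s in Ico c d ∩ T, (interpRate T p s -
      cylinder (graininess T (lastPoint T s)) (p (lastPoint T s))) = 0 := by
    refine integral_eq_zero_of_ae ?_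
    filter_upwards [ae_restrict_mem (measurableSet_Ico.inter hT.measurableSet),
      ae_restrict_of_ae ((countable_not_rightDense T).ae_notMem volume)] with s hs hsN
    have hr : RightDense T s := by
      by_contra h
      exact hsN ⟨hs.2, h⟩
    simp [interpRate, lastPoint_of_mem hs.2, graininess, hr.2, cylinder]
  have h2 : ∫ s in Ico c d \ T, (interpRate T p s -
      cylinder (graininess T (lastPoint T s)) (p (lastPoint T s))) = 0 := by
    have hcount : Countable ↥({t ∈ T | ¬ RightDense T t} ∩ Ico c d) :=
      ((countable_not_rightDense T).mono inter_subset_left).to_subtype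
    have hint := hi.mono_set (sdiff_subset (s := Ico c d) (t := T))
    rw [diff_eq_iUnion_gaps hT hc hd] at hint ⊢
    rw [integral_iUnion (fun _ => measurableSet_Ioo) _ hint]
    · refine (tsum_congr fun t => ?_).trans tsum_zero
      obtain ⟨t, ⟨ht, hr⟩, hct, htd⟩ := t
      have hσ : t < sigma T t :=
        lt_of_le_of_ne (le_sigma T t) fun h => hr ⟨⟨d, hd, htd⟩, h.symm⟩
      rw [← integral_gap hσ (hp0 t)]
      refine setIntegral_congr_fun measurableSet_Ioo fun s hs => ?_
      have : lastPoint T s = t :=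
        lastPoint_eq_of_gap ht hs.1.le fun r hr htr => hs.2.trans_le (sigma_le hr htr)
      simp only [interpRate, this, graininess]
    · rintro ⟨t, ⟨ht, _⟩, _⟩ ⟨t', ⟨ht', _⟩, _⟩ hne
      refine Set.disjoint_left.2 fun s hs hs' => hne ?_
      have h1 : lastPoint T s = t :=
        lastPoint_eq_of_gap ht hs.1.le fun r hr htr => hs.2.trans_le (sigma_le hr htr)
      have h2 : lastPoint T s = t' :=
        lastPoint_eq_of_gap ht' hs'.1.le fun r hr htr => hs'.2.trans_le (sigma_le hr htr)
      exact Subtype.ext (h1.symm.trans h2)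
  rw [h1, h2, add_zero]

end Gap

/-! ### Grönwall's inequality on a time scale -/

section Gronwall

variable {T : Set ℝ} {c d M C : ℝ} {p φ : ℝ → ℝ}

/-- Grönwall's inequality on a time scale with a positive constant term. With `m(s) = p(t) φ(t)`,
where `t` is the last point of `T` before `s`, the majorant `U(x) = C + ∫_c^x m` is affine on the
gaps, and its logarithm has the derivative `m / U ≤ interpRate T p` almost everywhere. -/
theorem gronwall_of_pos (hT : IsClosed T) (hc : c ∈ T) (hd : d ∈ T) (hcd : c ≤ d)
    (hp : Measurable p) (hp0 : ∀ t, 0 ≤ p t) (hpM : ∀ t ∈ Icc c d, p t ≤ M)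
    (hφ : Measurable φ) (hφ0 : ∀ t, 0 ≤ φ t) (hφM : ∀ t ∈ Icc c d, φ t ≤ M) (hC : 0 < C)
    (h : ∀ x ∈ T, c ≤ x → x ≤ d → φ x ≤ C + ∫ t in Ico c x, p t * φ t ∂deltaMeasure T) :
    φ d ≤ C * Real.exp (∫ t in Ico c d, cylinder (graininess T t) (p t) ∂deltaMeasure T) := by
  set m : ℝ → ℝ := fun s => p (lastPoint T s) * φ (lastPoint T s) with hm
  have hρ : ∀ s ∈ Icc c d, lastPoint T s ∈ Icc c d := fun s hs =>
    ⟨le_lastPoint hc hs.1, (lastPoint_le hc hs.1).trans hs.2⟩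
  have hM0 : 0 ≤ M := (hp0 c).trans (hpM c ⟨le_rfl, hcd⟩)
  have hm0 : ∀ s, 0 ≤ m s := fun s => mul_nonneg (hp0 _) (hφ0 _)
  have hmM : ∀ s ∈ Icc c d, m s ≤ M * M := fun s hs =>
    mul_le_mul (hpM _ (hρ s hs)) (hφM _ (hρ s hs)) (hφ0 _) hM0
  have hmi : IntegrableOn m (Icc c d) := by
    refine Integrable.of_bound
      ((hp.mul hφ).comp_aemeasurable (aemeasurable_lastPoint_Icc hc)).aestronglyMeasurable
      (M * M) ?_
    filter_upwards [ae_restrict_mem measurableSet_Icc] with s hs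
    exact (abs_of_nonneg (hm0 s)).trans_le (hmM s hs)
  have hmint : ∀ x ∈ Icc c d, ∀ y ∈ Icc c d, IntervalIntegrable m volume x y := fun x hx y hy =>
    (hmi.mono_set (uIcc_subset_Icc hx hy)).intervalIntegrable
  have hcI : c ∈ Icc c d := ⟨le_rfl, hcd⟩
  have hdI : d ∈ Icc c d := ⟨hcd, le_rfl⟩
  set U : ℝ → ℝ := fun x => C + ∫ s in c..x, m s with hU
  have hUC : ∀ x ∈ Icc c d, C ≤ U x := fun x hx =>
    le_add_of_nonneg_right (intervalIntegral.integral_nonneg hx.1 fun s _ => hm0 s)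
  have hUpos : ∀ x ∈ Icc c d, 0 < U x := fun x hx => hC.trans_le (hUC x hx)
  have hUsub : ∀ x ∈ Icc c d, ∀ y ∈ Icc c d, U x - U y = ∫ s in y..x, m s := by
    intro x hx y hy
    have := intervalIntegral.integral_add_adjacent_intervals (hmint c hcI y hy) (hmint y hy x hx)
    simp only [hU]
    linarith
  have hφU : ∀ x ∈ T, c ≤ x → x ≤ d → φ x ≤ U x := by
    intro x hx hcx hxd
    refine (h x hx hcx hxd).trans_eq ?_
    rw [setIntegral_deltaMeasure_Ico (φ := fun t => p t * φ t) hc hx (hp.mul hφ),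
      integral_Ico_eq_integral_Ioc, ← intervalIntegral.integral_of_le hcx]
  have hUlin : ∀ x ∈ Icc c d, U x = U (lastPoint T x) + m x * (x - lastPoint T x) := by
    intro x hx
    have h1 : ∫ s in lastPoint T x..x, m s = ∫ s in lastPoint T x..x, m x := by
      refine intervalIntegral.integral_congr fun s hs => ?_
      rw [uIcc_of_le (lastPoint_le hc hx.1)] at hs
      have : lastPoint T s = lastPoint T x := by
        refine le_antisymm ?_ (le_lastPoint (lastPoint_mem hT hc hx.1) hs.1)
        exact le_lastPoint (lastPoint_mem hT hc ((hρ x hx).1.trans hs.1))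
          ((lastPoint_le hc ((hρ x hx).1.trans hs.1)).trans hs.2)
      simp only [hm, this]
    have h2 := hUsub x hx _ (hρ x hx)
    rw [h1, intervalIntegral.integral_const, smul_eq_mul] at h2
    linarith
  have hlip : LipschitzOnWith (Real.toNNReal (M * M / C)) (fun x => Real.log (U x))
      (uIcc c d) := by
    rw [uIcc_of_le hcd]
    refine LipschitzOnWith.of_le_add_mul _ fun x hx y hy => ?_
    rw [Real.coe_toNNReal _ (div_nonneg (mul_nonneg hM0 hM0) hC.le)]
    have h1 : |U x - U y| ≤ M * M * |x - y| := by
      rw [hUsub x hx y hy, ← Real.norm_eq_abs]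
      refine intervalIntegral.norm_integral_le_of_norm_le_const fun s hs => ?_
      rw [Real.norm_eq_abs, abs_of_nonneg (hm0 s)]
      exact hmM s (uIcc_subset_Icc hy hx (uIoc_subset_uIcc hs))
    have h2 : Real.log (U x) - Real.log (U y) ≤ U x / U y - 1 := by
      rw [← Real.log_div (hUpos x hx).ne' (hUpos y hy).ne']
      exact Real.log_le_sub_one_of_pos (div_pos (hUpos x hx) (hUpos y hy))
    have h3 : U x / U y - 1 ≤ M * M * |x - y| / C := by
      rw [div_sub_one (hUpos y hy).ne']
      exact div_le_div₀ (mul_nonneg (mul_nonneg hM0 hM0) (abs_nonneg _))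
        ((le_abs_self _).trans h1) hC (hUC y hy)
    rw [Real.dist_eq, div_mul_eq_mul_div]
    linarith
  have hac := hlip.absolutelyContinuousOnInterval
  have hderiv : ∀ᵐ x, x ∈ Icc c d → deriv (fun x => Real.log (U x)) x ≤ interpRate T p x := by
    filter_upwards [(hmint c hcI d hdI).ae_hasDerivAt_integral] with x hx hxI
    rw [uIcc_of_le hcd] at hx
    have h1 : HasDerivAt U (m x) x := (hx hxI c hcI).const_add C
    rw [(h1.log (hUpos x hxI).ne').deriv, interpRate]
    have h2 : φ (lastPoint T x) ≤ U (lastPoint T x) :=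
      hφU _ (lastPoint_mem hT hc hxI.1) (hρ x hxI).1 (hρ x hxI).2
    have h3 : 0 ≤ x - lastPoint T x := sub_nonneg.2 (lastPoint_le hc hxI.1)
    rw [div_le_div_iff₀ (hUpos x hxI) (by nlinarith [mul_nonneg (hp0 (lastPoint T x)) h3]),
      hUlin x hxI]
    have h4 := mul_le_mul_of_nonneg_left h2 (hp0 (lastPoint T x))
    simp only [hm]
    nlinarith
  have hlog : Real.log (U d) - Real.log C ≤ ∫ s in Ico c d, interpRate T p s := by
    have hUc : U c = C := by simp [hU]
    have hftc := hac.integral_deriv_eq_sub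
    rw [hUc] at hftc
    rw [← hftc, integral_Ico_eq_integral_Ioc, ← intervalIntegral.integral_of_le hcd]
    refine intervalIntegral.integral_mono_ae_restrict hcd hac.intervalIntegrable_deriv ?_ ?_
    · refine IntegrableOn.intervalIntegrable ?_
      rw [uIcc_of_le hcd]
      exact integrableOn_interpRate hc hp hp0 hpM
    · filter_upwards [ae_restrict_of_ae hderiv, ae_restrict_mem measurableSet_Icc] with x hx hxI
      exact hx hxI
  rw [integral_interpRate hT hc hd hp hp0 hpM] at hlog
  refine (hφU d hd hcd le_rfl).trans ?_
  rw [← Real.log_le_log_iff (hUpos d hdI) (by positivity), Real.log_mul hC.ne' (by positivity),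
    Real.log_exp]
  linarith

theorem gronwall (hT : IsClosed T) (hc : c ∈ T) (hd : d ∈ T) (hcd : c ≤ d)
    (hp : Measurable p) (hp0 : ∀ t, 0 ≤ p t) (hpM : ∀ t ∈ Icc c d, p t ≤ M)
    (hφ : Measurable φ) (hφ0 : ∀ t, 0 ≤ φ t) (hφM : ∀ t ∈ Icc c d, φ t ≤ M) (hC : 0 ≤ C)
    (h : ∀ x ∈ T, c ≤ x → x ≤ d → φ x ≤ C + ∫ t in Ico c x, p t * φ t ∂deltaMeasure T) :
    φ d ≤ C * Real.exp (∫ t in Ico c d, cylinder (graininess T t) (p t) ∂deltaMeasure T) := by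
  set E := Real.exp (∫ t in Ico c d, cylinder (graininess T t) (p t) ∂deltaMeasure T)
  have hE : 0 < E := Real.exp_pos _
  refine le_of_forall_pos_le_add fun ε hε => ?_
  have := gronwall_of_pos (C := C + ε / E) hT hc hd hcd hp hp0 hpM hφ hφ0 hφM (by positivity)
    fun x hx hcx hxd => (h x hx hcx hxd).trans
      (by gcongr; exact le_add_of_nonneg_right (by positivity))
  rwa [add_mul, div_mul_cancel₀ _ hE.ne'] at this

end Gronwall

/-! ### Iterated delta integrals as integrals over a product measure -/

instance (T : Set ℝ) : SFinite (deltaMeasure T) := by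
  unfold deltaMeasure
  infer_instance

theorem deltaIntegral_of_le {T : Set ℝ} {c d : ℝ} (hcd : c ≤ d) (φ : ℝ → ℝ) :
    deltaIntegral T c d φ = ∫ t in Ico c d, φ t ∂deltaMeasure T := by
  rw [deltaIntegral, Ico_eq_empty (not_lt.2 hcd)]
  simp

theorem setIntegral_deltaMeasure_congr {T : Set ℝ} (hT : IsClosed T) {c d : ℝ} {φ ψ : ℝ → ℝ}
    (h : ∀ t ∈ T, t ∈ Ico c d → φ t = ψ t) :
    ∫ t in Ico c d, φ t ∂deltaMeasure T = ∫ t in Ico c d, ψ t ∂deltaMeasure T := by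
  refine setIntegral_congr_ae measurableSet_Ico ?_
  filter_upwards [ae_mem_deltaMeasure hT] with t ht
  exact h t ht

namespace Domain

variable (D : Domain)

/-- The set `H` as a subset of `ℝ × ℝ × ℝ`. -/
def carrier : Set (ℝ × ℝ × ℝ) :=
  (D.T₁ ∩ Ici D.x₀) ×ˢ (D.T₂ ∩ Ici D.y₀) ×ˢ (D.T₃ ∩ Icc D.a D.b)

/-- The product of the delta measures of `T₂` and `T₃`. -/
def deltaVolume₂ : Measure (ℝ × ℝ) := (deltaMeasure D.T₂).prod (deltaMeasure D.T₃)

/-- The product of the delta measures of the three time scales. -/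
def deltaVolume : Measure (ℝ × ℝ × ℝ) := (deltaMeasure D.T₁).prod D.deltaVolume₂

/-- The range of integration in the variables `(t, q)`. -/
def rect (y : ℝ) : Set (ℝ × ℝ) := Ico D.y₀ y ×ˢ Ico D.a D.b

/-- The range of integration in the variables `(s, t, q)`. -/
def box (x y : ℝ) : Set (ℝ × ℝ × ℝ) := Ico D.x₀ x ×ˢ D.rect y

/-- The extension by zero of a function on `H`. -/
def zeroExtend (φ : ℝ → ℝ → ℝ → ℝ) : ℝ × ℝ × ℝ → ℝ :=
  D.carrier.indicator fun p => φ p.1 p.2.1 p.2.2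

instance : SFinite D.deltaVolume₂ := by
  unfold deltaVolume₂
  infer_instance

instance : SFinite D.deltaVolume := by
  unfold deltaVolume
  infer_instance

theorem isClosed₁ : IsClosed (D.T₁ ∩ Ici D.x₀) := D.isTimeScale₁.isClosed.inter isClosed_Ici

theorem isClosed₂ : IsClosed (D.T₂ ∩ Ici D.y₀) := D.isTimeScale₂.isClosed.inter isClosed_Ici

theorem isClosed₃ : IsClosed (D.T₃ ∩ Icc D.a D.b) := D.isTimeScale₃.isClosed.inter isClosed_Icc

theorem measurableSet_carrier : MeasurableSet D.carrier :=
  D.isClosed₁.measurableSet.prod (D.isClosed₂.measurableSet.prod D.isClosed₃.measurableSet)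

theorem measurableSet_rect (y : ℝ) : MeasurableSet (D.rect y) :=
  measurableSet_Ico.prod measurableSet_Ico

theorem measurableSet_box (x y : ℝ) : MeasurableSet (D.box x y) :=
  measurableSet_Ico.prod (D.measurableSet_rect y)

theorem rect_mono {y y' : ℝ} (h : y ≤ y') : D.rect y ⊆ D.rect y' :=
  prod_mono (Ico_subset_Ico_right h) le_rfl

theorem box_mono {x x' y y' : ℝ} (hx : x ≤ x') (hy : y ≤ y') : D.box x y ⊆ D.box x' y' :=
  prod_mono (Ico_subset_Ico_right hx) (D.rect_mono hy)

theorem deltaVolume₂_rect_lt_top {y : ℝ} (hy : y ∈ D.T₂) : D.deltaVolume₂ (D.rect y) < ⊤ := by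
  rw [deltaVolume₂, rect, Measure.prod_prod, deltaMeasure_Ico D.y₀_mem hy,
    deltaMeasure_Ico D.a_mem D.b_mem]
  exact ENNReal.mul_lt_top ENNReal.ofReal_lt_top ENNReal.ofReal_lt_top

theorem deltaVolume_box_lt_top {x y : ℝ} (hx : x ∈ D.T₁) (hy : y ∈ D.T₂) :
    D.deltaVolume (D.box x y) < ⊤ := by
  rw [deltaVolume, box, Measure.prod_prod, deltaMeasure_Ico D.x₀_mem hx]
  exact ENNReal.mul_lt_top ENNReal.ofReal_lt_top (D.deltaVolume₂_rect_lt_top hy)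

/-- Functions that are Borel measurable, supported in `H`, and bounded on the bounded parts of `H`:
the class of extensions by zero of rd-continuous functions, enlarged so as to be stable under
integration over `box x y`. -/
structure Regular (φ : ℝ × ℝ × ℝ → ℝ) : Prop where
  measurable : Measurable φ
  eq_zero : ∀ p ∉ D.carrier, φ p = 0
  bounded : ∀ X ∈ D.T₁, ∀ Y ∈ D.T₂, ∃ M, ∀ p ∈ D.carrier, p.1 ≤ X → p.2.1 ≤ Y → |φ p| ≤ M

/-- The analogue of `Regular` for functions on `H × H`. -/
structure RegularKernel (Θ : (ℝ × ℝ × ℝ) × ℝ × ℝ × ℝ → ℝ) : Prop where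
  measurable : Measurable Θ
  eq_zero : ∀ p p', p' ∉ D.carrier → Θ (p, p') = 0
  bounded : ∀ X ∈ D.T₁, ∀ Y ∈ D.T₂, ∃ M, ∀ p ∈ D.carrier, ∀ p' ∈ D.carrier,
    p.1 ≤ X → p.2.1 ≤ Y → p'.1 ≤ X → p'.2.1 ≤ Y → |Θ (p, p')| ≤ M

variable {D}

theorem integrableOn_rect_of_bound {φ : ℝ × ℝ → ℝ} (hφ : Measurable φ) {Y M : ℝ} (hY : Y ∈ D.T₂)
    (hM : ∀ p ∈ D.rect Y, |φ p| ≤ M) : IntegrableOn φ (D.rect Y) D.deltaVolume₂ :=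
  Measure.integrableOn_of_bounded (D.deltaVolume₂_rect_lt_top hY).ne hφ.aestronglyMeasurable
    ((ae_restrict_mem (D.measurableSet_rect Y)).mono hM)

theorem integrableOn_box_of_bound {φ : ℝ × ℝ × ℝ → ℝ} (hφ : Measurable φ) {X Y M : ℝ}
    (hX : X ∈ D.T₁) (hY : Y ∈ D.T₂) (hM : ∀ p ∈ D.box X Y, |φ p| ≤ M) :
    IntegrableOn φ (D.box X Y) D.deltaVolume :=
  Measure.integrableOn_of_bounded (D.deltaVolume_box_lt_top hX hY).ne hφ.aestronglyMeasurable
    ((ae_restrict_mem (D.measurableSet_box X Y)).mono hM)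

namespace Regular

variable {φ ψ : ℝ × ℝ × ℝ → ℝ}

theorem exists_bound (hφ : D.Regular φ) {X Y : ℝ} (hX : X ∈ D.T₁) (hY : Y ∈ D.T₂) :
    ∃ M, 0 ≤ M ∧ ∀ p : ℝ × ℝ × ℝ, p.1 ≤ X → p.2.1 ≤ Y → |φ p| ≤ M := by
  obtain ⟨M, hM⟩ := hφ.bounded X hX Y hY
  refine ⟨max M 0, le_max_right _ _, fun p hX hY => ?_⟩
  by_cases hp : p ∈ D.carrier
  · exact (hM p hp hX hY).trans (le_max_left _ _)
  · rw [hφ.eq_zero p hp, abs_zero]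
    exact le_max_right _ _

theorem add (hφ : D.Regular φ) (hψ : D.Regular ψ) : D.Regular fun p => φ p + ψ p where
  measurable := hφ.measurable.add hψ.measurable
  eq_zero p hp := by rw [hφ.eq_zero p hp, hψ.eq_zero p hp, add_zero]
  bounded X hX Y hY := by
    obtain ⟨M, hM⟩ := hφ.bounded X hX Y hY
    obtain ⟨N, hN⟩ := hψ.bounded X hX Y hY
    exact ⟨M + N, fun p hp h1 h2 =>
      (abs_add_le _ _).trans (add_le_add (hM p hp h1 h2) (hN p hp h1 h2))⟩

theorem mul (hφ : D.Regular φ) (hψ : D.Regular ψ) : D.Regular fun p => φ p * ψ p where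
  measurable := hφ.measurable.mul hψ.measurable
  eq_zero p hp := by rw [hφ.eq_zero p hp, zero_mul]
  bounded X hX Y hY := by
    obtain ⟨M, hM0, hM⟩ := hφ.exists_bound hX hY
    obtain ⟨N, hN⟩ := hψ.bounded X hX Y hY
    refine ⟨M * N, fun p hp h1 h2 => ?_⟩
    rw [abs_mul]
    exact mul_le_mul (hM p h1 h2) (hN p hp h1 h2) (abs_nonneg _) hM0

theorem sub (hφ : D.Regular φ) (hψ : D.Regular ψ) : D.Regular fun p => φ p - ψ p where
  measurable := hφ.measurable.sub hψ.measurable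
  eq_zero p hp := by rw [hφ.eq_zero p hp, hψ.eq_zero p hp, sub_zero]
  bounded X hX Y hY := by
    obtain ⟨M, hM⟩ := hφ.bounded X hX Y hY
    obtain ⟨N, hN⟩ := hψ.bounded X hX Y hY
    exact ⟨M + N, fun p hp h1 h2 =>
      (abs_sub _ _).trans (add_le_add (hM p hp h1 h2) (hN p hp h1 h2))⟩

theorem abs (hφ : D.Regular φ) : D.Regular fun p => |φ p| where
  measurable := hφ.measurable.abs
  eq_zero p hp := by rw [hφ.eq_zero p hp, abs_zero]
  bounded X hX Y hY := by
    obtain ⟨M, hM⟩ := hφ.bounded X hX Y hY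
    exact ⟨M, fun p hp h1 h2 => (abs_abs (φ p)).trans_le (hM p hp h1 h2)⟩

theorem integrableOn (hφ : D.Regular φ) {X Y : ℝ} (hX : X ∈ D.T₁) (hY : Y ∈ D.T₂) :
    IntegrableOn φ (D.box X Y) D.deltaVolume := by
  obtain ⟨M, -, hM⟩ := hφ.exists_bound hX hY
  exact integrableOn_box_of_bound hφ.measurable hX hY fun p hp => hM p hp.1.2.le hp.2.1.2.le

theorem setIntegral_rect (hφ : D.Regular φ) {s Y : ℝ} (hs : s ∈ D.T₁) (hY : Y ∈ D.T₂) :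
    ∫ p in D.rect Y, φ (s, p) ∂D.deltaVolume₂ =
      ∫ t in Ico D.y₀ Y, ∫ q in Ico D.a D.b, φ (s, t, q) ∂deltaMeasure D.T₃ ∂deltaMeasure D.T₂ := by
  obtain ⟨M, -, hM⟩ := hφ.exists_bound hs hY
  exact setIntegral_prod _ (integrableOn_rect_of_bound
    (hφ.measurable.comp measurable_prodMk_left) hY fun p hp => hM (s, p) le_rfl hp.1.2.le)

theorem setIntegral_rect_eq (hφ : D.Regular φ) {s y : ℝ} (hs : s ∈ D.T₁ ∩ Ici D.x₀)
    (hy : y ∈ D.T₂ ∩ Ici D.y₀) {ψ : ℝ → ℝ → ℝ}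
    (h : ∀ t q, D.Mem s t q → ψ t q = φ (s, t, q)) :
    (deltaIntegral D.T₂ D.y₀ y fun t => deltaIntegral D.T₃ D.a D.b fun q => ψ t q) =
      ∫ p in D.rect y, φ (s, p) ∂D.deltaVolume₂ := by
  rw [hφ.setIntegral_rect hs.1 hy.1, deltaIntegral_of_le hy.2]
  refine setIntegral_deltaMeasure_congr D.isTimeScale₂.isClosed fun t ht htI => ?_
  rw [deltaIntegral_of_le D.a_le_b]
  refine setIntegral_deltaMeasure_congr D.isTimeScale₃.isClosed fun q hq hqI => ?_
  exact h t q ⟨hs, ⟨ht, htI.1⟩, hq, Ico_subset_Icc_self hqI⟩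

theorem tripleIntegral_eq (hφ : D.Regular φ) {x y : ℝ} (hx : x ∈ D.T₁ ∩ Ici D.x₀)
    (hy : y ∈ D.T₂ ∩ Ici D.y₀) {ψ : ℝ → ℝ → ℝ → ℝ}
    (h : ∀ s t q, D.Mem s t q → ψ s t q = φ (s, t, q)) :
    D.tripleIntegral x y ψ = ∫ p in D.box x y, φ p ∂D.deltaVolume := by
  have hprod : ∫ p in D.box x y, φ p ∂D.deltaVolume =
      ∫ s in Ico D.x₀ x, ∫ p in D.rect y, φ (s, p) ∂D.deltaVolume₂ ∂deltaMeasure D.T₁ :=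
    setIntegral_prod φ (hφ.integrableOn hx.1 hy.1)
  rw [hprod, tripleIntegral, deltaIntegral_of_le hx.2]
  refine setIntegral_deltaMeasure_congr D.isTimeScale₁.isClosed fun s hs hsI => ?_
  exact hφ.setIntegral_rect_eq ⟨hs, hsI.1⟩ hy (h s)

end Regular

namespace RegularKernel

variable {Θ Ξ : (ℝ × ℝ × ℝ) × ℝ × ℝ × ℝ → ℝ}

theorem sub (hΘ : D.RegularKernel Θ) (hΞ : D.RegularKernel Ξ) :
    D.RegularKernel fun p => Θ p - Ξ p where
  measurable := hΘ.measurable.sub hΞ.measurable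
  eq_zero p p' hp := by rw [hΘ.eq_zero p p' hp, hΞ.eq_zero p p' hp, sub_zero]
  bounded X hX Y hY := by
    obtain ⟨M, hM⟩ := hΘ.bounded X hX Y hY
    obtain ⟨N, hN⟩ := hΞ.bounded X hX Y hY
    exact ⟨M + N, fun p hp p' hp' h1 h2 h3 h4 => (abs_sub _ _).trans
      (add_le_add (hM p hp p' hp' h1 h2 h3 h4) (hN p hp p' hp' h1 h2 h3 h4))⟩

theorem abs (hΘ : D.RegularKernel Θ) : D.RegularKernel fun p => |Θ p| where
  measurable := hΘ.measurable.abs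
  eq_zero p p' hp := by rw [hΘ.eq_zero p p' hp, abs_zero]
  bounded X hX Y hY := by
    obtain ⟨M, hM⟩ := hΘ.bounded X hX Y hY
    exact ⟨M, fun p hp p' hp' h1 h2 h3 h4 =>
      (abs_abs (Θ (p, p'))).trans_le (hM p hp p' hp' h1 h2 h3 h4)⟩

theorem regular_right (hΘ : D.RegularKernel Θ) {p : ℝ × ℝ × ℝ} (hp : p ∈ D.carrier) :
    D.Regular fun p' => Θ (p, p') where
  measurable := hΘ.measurable.comp measurable_prodMk_left
  eq_zero p' hp' := hΘ.eq_zero p p' hp'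
  bounded X hX Y hY := by
    have hX' : max X p.1 ∈ D.T₁ := by
      rcases max_choice X p.1 with h | h <;> rw [h]
      exacts [hX, hp.1.1]
    have hY' : max Y p.2.1 ∈ D.T₂ := by
      rcases max_choice Y p.2.1 with h | h <;> rw [h]
      exacts [hY, hp.2.1.1]
    obtain ⟨M, hM⟩ := hΘ.bounded _ hX' _ hY'
    exact ⟨M, fun p' hp' h1 h2 => hM p hp p' hp' (le_max_right _ _) (le_max_right _ _)
      (h1.trans (le_max_left _ _)) (h2.trans (le_max_left _ _))⟩

theorem regular_integral (hΘ : D.RegularKernel Θ) :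
    D.Regular (D.carrier.indicator fun p => ∫ p' in D.box p.1 p.2.1, Θ (p, p') ∂D.deltaVolume) where
  measurable := by
    refine Measurable.indicator ?_ D.measurableSet_carrier
    -- The range of integration depends on `p`, hence an indicator function in the integrand.
    let S : Set ((ℝ × ℝ × ℝ) × ℝ × ℝ × ℝ) := {z | z.2 ∈ D.box z.1.1 z.1.2.1}
    have hS : MeasurableSet S := by
      have : S = {z | D.x₀ ≤ z.2.1} ∩ {z | z.2.1 < z.1.1} ∩ ({z | D.y₀ ≤ z.2.2.1} ∩
          {z | z.2.2.1 < z.1.2.1} ∩ ({z | D.a ≤ z.2.2.2} ∩ {z | z.2.2.2 < D.b})) := by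
        ext z
        simp only [S, box, rect, mem_ofPred_eq, mem_prod, mem_Ico, mem_inter_iff]
      rw [this]
      refine MeasurableSet.inter (MeasurableSet.inter ?_ ?_) (MeasurableSet.inter
        (MeasurableSet.inter ?_ ?_) (MeasurableSet.inter ?_ ?_))
      · exact measurableSet_le (by fun_prop) (by fun_prop)
      · exact measurableSet_lt (by fun_prop) (by fun_prop)
      · exact measurableSet_le (by fun_prop) (by fun_prop)
      · exact measurableSet_lt (by fun_prop) (by fun_prop)
      · exact measurableSet_le (by fun_prop) (by fun_prop)
      · exact measurableSet_lt (by fun_prop) (by fun_prop)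
    have h1 := ((hΘ.measurable.indicator hS).stronglyMeasurable.integral_prod_right'
      (ν := D.deltaVolume)).measurable
    convert h1 using 2 with p
    rw [← integral_indicator (D.measurableSet_box _ _)]
    rfl
  eq_zero p hp := indicator_of_notMem hp _
  bounded X hX Y hY := by
    obtain ⟨M, hM⟩ := hΘ.bounded X hX Y hY
    refine ⟨max M 0 * D.deltaVolume.real (D.box X Y), fun p hp h1 h2 => ?_⟩
    have hsub := D.box_mono h1 h2
    have hfin := D.deltaVolume_box_lt_top hX hY
    rw [indicator_of_mem hp, ← Real.norm_eq_abs]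
    refine (norm_setIntegral_le_of_norm_le_const (C := max M 0)
      ((measure_mono hsub).trans_lt hfin) fun p' hp' => ?_).trans ?_
    · by_cases hp'D : p' ∈ D.carrier
      · exact (hM p hp p' hp'D h1 h2 (hp'.1.2.le.trans h1) (hp'.2.1.2.le.trans h2)).trans
          (le_max_left _ _)
      · rw [hΘ.eq_zero p p' hp'D, norm_zero]
        exact le_max_right _ _
    · exact mul_le_mul_of_nonneg_left (measureReal_mono hsub hfin.ne) (le_max_right _ _)

end RegularKernel

/-! ### Regularity of rd-continuous functions -/

theorem regular_zeroExtend {φ : ℝ → ℝ → ℝ → ℝ} (hφ : D.Crd φ) : D.Regular (D.zeroExtend φ) where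
  measurable := by
    have hm := measurable_indicator_of_rdContinuous (T := ![D.T₁ ∩ Ici D.x₀, D.T₂ ∩ Ici D.y₀,
      D.T₃ ∩ Icc D.a D.b]) (by
        intro i
        fin_cases i
        exacts [D.isClosed₁, D.isClosed₂, D.isClosed₃]) hφ
    have hv : Measurable fun p : ℝ × ℝ × ℝ => (![p.1, p.2.1, p.2.2] : Fin 3 → ℝ) := by
      refine measurable_pi_lambda _ fun i => ?_
      fin_cases i
      exacts [measurable_fst, measurable_snd.fst, measurable_snd.snd]
    convert hm.comp hv using 1
    funext p
    by_cases hp : p ∈ D.carrier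
    · rw [zeroExtend, indicator_of_mem hp, Function.comp_apply, indicator_of_mem]
      · rfl
      · intro i _
        fin_cases i
        exacts [hp.1, hp.2.1, hp.2.2]
    · rw [zeroExtend, indicator_of_notMem hp, Function.comp_apply, indicator_of_notMem]
      exact fun h => hp ⟨h 0 (mem_univ _), h 1 (mem_univ _), h 2 (mem_univ _)⟩
  eq_zero p hp := indicator_of_notMem hp _
  bounded X hX Y hY := by
    obtain ⟨M, hM⟩ := exists_bound_of_rdContinuous hφ
      (K := univ.pi ![D.T₁ ∩ Icc D.x₀ X, D.T₂ ∩ Icc D.y₀ Y, D.T₃ ∩ Icc D.a D.b]) (by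
        refine isCompact_univ_pi fun i => ?_
        fin_cases i
        exacts [isCompact_Icc.inter_left D.isTimeScale₁.isClosed,
          isCompact_Icc.inter_left D.isTimeScale₂.isClosed,
          isCompact_Icc.inter_left D.isTimeScale₃.isClosed]) (by
        refine pi_mono fun i _ => ?_
        fin_cases i
        exacts [inter_subset_inter_right _ Icc_subset_Ici_self,
          inter_subset_inter_right _ Icc_subset_Ici_self, le_rfl])
    refine ⟨M, fun p hp h1 h2 => ?_⟩
    rw [zeroExtend, indicator_of_mem hp]
    refine hM ![p.1, p.2.1, p.2.2] fun i _ => ?_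
    fin_cases i
    exacts [⟨hp.1.1, hp.1.2, h1⟩, ⟨hp.2.1.1, hp.2.1.2, h2⟩, hp.2.2]

/-- The extension by zero of `(p, p') ↦ Φ(p, p', φ(p'))` from `H × H`. -/
def kernelExtend (D : Domain) (Φ : ℝ → ℝ → ℝ → ℝ → ℝ → ℝ → ℝ → ℝ) (φ : ℝ → ℝ → ℝ → ℝ) :
    (ℝ × ℝ × ℝ) × ℝ × ℝ × ℝ → ℝ :=
  (D.carrier ×ˢ D.carrier).indicator fun z =>
    Φ z.1.1 z.1.2.1 z.1.2.2 z.2.1 z.2.2.1 z.2.2.2 (φ z.2.1 z.2.2.1 z.2.2.2)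

theorem regularKernel_kernelExtend {Φ : ℝ → ℝ → ℝ → ℝ → ℝ → ℝ → ℝ → ℝ} {φ : ℝ → ℝ → ℝ → ℝ}
    (hΦ : D.CrdKernel Φ) (hφ : D.Crd φ) : D.RegularKernel (D.kernelExtend Φ φ) where
  measurable := by
    have hm := measurable_indicator_of_rdContinuous (T := ![D.T₁ ∩ Ici D.x₀, D.T₂ ∩ Ici D.y₀,
      D.T₃ ∩ Icc D.a D.b, D.T₁ ∩ Ici D.x₀, D.T₂ ∩ Ici D.y₀, D.T₃ ∩ Icc D.a D.b, univ]) (by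
        intro i
        fin_cases i
        exacts [D.isClosed₁, D.isClosed₂, D.isClosed₃, D.isClosed₁, D.isClosed₂, D.isClosed₃,
          isClosed_univ]) hΦ
    have hφm := (regular_zeroExtend hφ).measurable
    have hv : Measurable fun z : (ℝ × ℝ × ℝ) × ℝ × ℝ × ℝ =>
        (![z.1.1, z.1.2.1, z.1.2.2, z.2.1, z.2.2.1, z.2.2.2, D.zeroExtend φ z.2] :
          Fin 7 → ℝ) := by
      refine measurable_pi_lambda _ fun i => ?_
      fin_cases i
      exacts [measurable_fst.fst, measurable_fst.snd.fst, measurable_fst.snd.snd,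
        measurable_snd.fst, measurable_snd.snd.fst, measurable_snd.snd.snd,
        hφm.comp measurable_snd]
    convert (hm.comp hv).indicator (D.measurableSet_carrier.prod D.measurableSet_carrier) using 1
    refine indicator_congr fun z hz => ?_
    rw [Function.comp_apply, indicator_of_mem, zeroExtend, indicator_of_mem hz.2]
    · rfl
    · intro i _
      fin_cases i
      exacts [hz.1.1, hz.1.2.1, hz.1.2.2, hz.2.1, hz.2.2.1, hz.2.2.2, mem_univ _]
  eq_zero p p' hp' := indicator_of_notMem (fun h => hp' h.2) _
  bounded X hX Y hY := by
    obtain ⟨N, hN⟩ := (regular_zeroExtend hφ).bounded X hX Y hY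
    obtain ⟨M, hM⟩ := exists_bound_of_rdContinuous hΦ
      (K := univ.pi ![D.T₁ ∩ Icc D.x₀ X, D.T₂ ∩ Icc D.y₀ Y, D.T₃ ∩ Icc D.a D.b,
        D.T₁ ∩ Icc D.x₀ X, D.T₂ ∩ Icc D.y₀ Y, D.T₃ ∩ Icc D.a D.b, Icc (-N) N]) (by
        refine isCompact_univ_pi fun i => ?_
        fin_cases i
        exacts [isCompact_Icc.inter_left D.isTimeScale₁.isClosed,
          isCompact_Icc.inter_left D.isTimeScale₂.isClosed,
          isCompact_Icc.inter_left D.isTimeScale₃.isClosed,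
          isCompact_Icc.inter_left D.isTimeScale₁.isClosed,
          isCompact_Icc.inter_left D.isTimeScale₂.isClosed,
          isCompact_Icc.inter_left D.isTimeScale₃.isClosed, isCompact_Icc]) (by
        refine pi_mono fun i _ => ?_
        fin_cases i
        exacts [inter_subset_inter_right _ Icc_subset_Ici_self,
          inter_subset_inter_right _ Icc_subset_Ici_self, le_rfl,
          inter_subset_inter_right _ Icc_subset_Ici_self,
          inter_subset_inter_right _ Icc_subset_Ici_self, le_rfl, subset_univ _])
    refine ⟨M, fun p hp p' hp' h1 h2 h3 h4 => ?_⟩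
    have hφN := hN p' hp' h3 h4
    rw [zeroExtend, indicator_of_mem hp'] at hφN
    rw [kernelExtend, indicator_of_mem (mk_mem_prod hp hp')]
    refine hM ![p.1, p.2.1, p.2.2, p'.1, p'.2.1, p'.2.2, φ p'.1 p'.2.1 p'.2.2] fun i _ => ?_
    fin_cases i
    exacts [⟨hp.1.1, hp.1.2, h1⟩, ⟨hp.2.1.1, hp.2.1.2, h2⟩, hp.2.2,
      ⟨hp'.1.1, hp'.1.2, h3⟩, ⟨hp'.2.1.1, hp'.2.1.2, h4⟩, hp'.2.2, abs_le.1 hφN]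

end Domain

namespace Domain

variable {D : Domain}

/-! ### The integral inequality in three variables -/

/-- A Pachpatte-type inequality. With `Φ(x, y) = ∫ f w` over `box x y`, freezing `y` at its final
value `Y` inside the integral gives `Φ(x, Y) ≤ ∫ f A + ∫ Q(s) Φ(s, Y) Δs`, to which Grönwall's
inequality in the first variable applies. -/
theorem le_of_le_add_mul_integral {w A r f : ℝ × ℝ × ℝ → ℝ} (hw : D.Regular w) (hA : D.Regular A)
    (hr : D.Regular r) (hf : D.Regular f) (hw0 : ∀ p, 0 ≤ w p) (hA0 : ∀ p, 0 ≤ A p)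
    (hr0 : ∀ p, 0 ≤ r p) (hf0 : ∀ p, 0 ≤ f p)
    (h : ∀ p ∈ D.carrier,
      w p ≤ A p + r p * ∫ p' in D.box p.1 p.2.1, f p' * w p' ∂D.deltaVolume)
    {p : ℝ × ℝ × ℝ} (hp : p ∈ D.carrier) :
    w p ≤ A p + r p * ((∫ p' in D.box p.1 p.2.1, f p' * A p' ∂D.deltaVolume) *
      Real.exp (∫ s in Ico D.x₀ p.1, cylinder (graininess D.T₁ s)
        (∫ p' in D.rect p.2.1, f (s, p') * r (s, p') ∂D.deltaVolume₂) ∂deltaMeasure D.T₁)) := by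
  obtain ⟨X, Y, Z⟩ := p
  obtain ⟨⟨hX, hxX⟩, ⟨hY, hyY⟩, hZ⟩ := id hp
  simp only [mem_Ici] at hX hxX hY hyY
  refine (h _ hp).trans ?_
  gcongr
  · exact hr0 _
  dsimp only
  have hfw := hf.mul hw
  have hfA := hf.mul hA
  have hfr := hf.mul hr
  set Φ : ℝ → ℝ → ℝ := fun x y => ∫ p' in D.box x y, f p' * w p' ∂D.deltaVolume
  have hΦmono : ∀ x y x' y', x ≤ x' → y ≤ y' → x' ≤ X → y' ≤ Y → Φ x y ≤ Φ x' y' := by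
    intro x y x' y' hx hy hx' hy'
    refine setIntegral_mono_set ((hfw.integrableOn hX hY).mono_set (D.box_mono hx' hy'))
      (Eventually.of_forall fun p' => mul_nonneg (hf0 _) (hw0 _)) ?_
    exact (D.box_mono hx hy).eventuallyLE
  have hΦ0 : ∀ x y, 0 ≤ Φ x y := fun x y =>
    integral_nonneg fun p' => mul_nonneg (hf0 _) (hw0 _)
  -- The truncation at `X` makes `φ` monotone on the whole line, hence measurable.
  set φ : ℝ → ℝ := fun x => Φ (min x X) Y with hφ
  have hφmono : Monotone φ := fun x x' hx =>
    hΦmono _ _ _ _ (min_le_min_right X hx) le_rfl (min_le_right _ _) le_rfl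
  have hφX : ∀ x ≤ X, φ x = Φ x Y := fun x hx => by simp only [hφ, min_eq_left hx]
  have hφle : ∀ x, φ x ≤ Φ X Y := fun x =>
    hΦmono _ _ _ _ (min_le_right _ _) le_rfl le_rfl le_rfl
  set Q : ℝ → ℝ := fun s => ∫ p' in D.rect Y, f (s, p') * r (s, p') ∂D.deltaVolume₂ with hQ
  have hQm : Measurable Q :=
    (hfr.measurable.stronglyMeasurable.integral_prod_right'
      (ν := D.deltaVolume₂.restrict (D.rect Y))).measurable
  have hQ0 : ∀ s, 0 ≤ Q s := fun s => integral_nonneg fun p' => mul_nonneg (hf0 _) (hr0 _)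
  obtain ⟨M, hM0, hM⟩ := hfr.exists_bound hX hY
  have hQM : ∀ s ∈ Icc D.x₀ X, Q s ≤ M * D.deltaVolume₂.real (D.rect Y) := by
    intro s hs
    refine (Real.le_norm_self _).trans ?_
    exact norm_setIntegral_le_of_norm_le_const (D.deltaVolume₂_rect_lt_top hY)
      fun p' hp' => (hM (s, p') hs.2 hp'.1.2.le : ‖f (s, p') * r (s, p')‖ ≤ M)
  change Φ X Y ≤ _
  rw [← hφX X le_rfl]
  refine gronwall (M := max (M * D.deltaVolume₂.real (D.rect Y)) (Φ X Y))
    D.isTimeScale₁.isClosed D.x₀_mem hX hxX hQm hQ0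
    (fun s hs => (hQM s hs).trans (le_max_left _ _)) hφmono.measurable (fun s => hΦ0 _ _)
    (fun s _ => (hφle s).trans (le_max_right _ _))
    (integral_nonneg fun p' => mul_nonneg (hf0 _) (hA0 _)) fun x hx hxx hxX' => ?_
  rw [hφX x hxX']
  have hfrφ : IntegrableOn (fun p' : ℝ × ℝ × ℝ => f p' * r p' * φ p'.1) (D.box x Y)
      D.deltaVolume := by
    refine integrableOn_box_of_bound (M := M * Φ X Y)
      (hfr.measurable.mul (hφmono.measurable.comp measurable_fst)) hx hY fun p' hp' => ?_
    change |f p' * r p' * φ p'.1| ≤ _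
    rw [abs_mul, abs_of_nonneg (hΦ0 _ _ : 0 ≤ φ p'.1)]
    exact mul_le_mul (hM p' (hp'.1.2.le.trans hxX') hp'.2.1.2.le) (hφle _) (hΦ0 _ _) hM0
  have h1 : Φ x Y ≤ ∫ p' in D.box x Y, (f p' * A p' + f p' * r p' * φ p'.1) ∂D.deltaVolume := by
    refine setIntegral_mono_on (hfw.integrableOn hx hY) ((hfA.integrableOn hx hY).add hfrφ)
      (D.measurableSet_box x Y) fun p' hp' => ?_
    by_cases hp'D : p' ∈ D.carrier
    · have h2 : Φ p'.1 p'.2.1 ≤ φ p'.1 := by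
        rw [hφX _ (hp'.1.2.le.trans hxX')]
        exact hΦmono _ _ _ _ le_rfl hp'.2.1.2.le (hp'.1.2.le.trans hxX') le_rfl
      have h3 : w p' ≤ A p' + r p' * φ p'.1 :=
        (h p' hp'D).trans (add_le_add le_rfl (mul_le_mul_of_nonneg_left h2 (hr0 _)))
      calc f p' * w p' ≤ f p' * (A p' + r p' * φ p'.1) := mul_le_mul_of_nonneg_left h3 (hf0 _)
        _ = _ := by ring
    · simp [hf.eq_zero p' hp'D]
  rw [integral_add (hfA.integrableOn hx hY) hfrφ] at h1
  have h4 : ∫ p' in D.box x Y, f p' * A p' ∂D.deltaVolume ≤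
      ∫ p' in D.box X Y, f p' * A p' ∂D.deltaVolume :=
    setIntegral_mono_set (hfA.integrableOn hX hY)
      (Eventually.of_forall fun p' => mul_nonneg (hf0 _) (hA0 _))
      (D.box_mono hxX' le_rfl).eventuallyLE
  have h5 : ∫ p' in D.box x Y, f p' * r p' * φ p'.1 ∂D.deltaVolume =
      ∫ s in Ico D.x₀ x, Q s * φ s ∂deltaMeasure D.T₁ := by
    refine (setIntegral_prod _ hfrφ).trans ?_
    simp only [hQ, integral_mul_const]
  rw [h5] at h1
  linarith

end Domain

end TimeScale

/-! ### The comparison of the two solutions -/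

open TimeScale TimeScale.Domain in
theorem theorem3p3 (D : TimeScale.Domain)
    (g v r f u h : ℝ → ℝ → ℝ → ℝ) (F G : ℝ → ℝ → ℝ → ℝ → ℝ → ℝ → ℝ → ℝ)
    (hg : D.Crd g) (hv : D.Crd v) (hr : D.Crd r) (hf : D.Crd f)
    (hF : D.CrdKernel F) (hG : D.CrdKernel G)
    (hLip : D.LipschitzCondition F r f)
    (hu : D.IsSolution g F u) (hh : D.IsSolution v G h) :
    ∀ x y z, D.Mem x y z →
      |u x y z - h x y z| ≤
        (TimeScale.Domain.gBar g v x y z + D.kBar F G h x y z) +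
          r x y z * D.C₄ f g v F G h x y *
            TimeScale.deltaExp D.T₁ (fun s => D.Q₂ r f s y) x D.x₀ := by
  have hze : ∀ (φ : ℝ → ℝ → ℝ → ℝ) {x y z : ℝ}, D.Mem x y z →
      D.zeroExtend φ (x, y, z) = φ x y z := fun φ x y z hm =>
    indicator_of_mem (show (x, y, z) ∈ D.carrier from hm) _
  have hke : ∀ (Φ : ℝ → ℝ → ℝ → ℝ → ℝ → ℝ → ℝ → ℝ) (φ : ℝ → ℝ → ℝ → ℝ) {x y z s t q : ℝ},
      D.Mem x y z → D.Mem s t q →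
      D.kernelExtend Φ φ ((x, y, z), s, t, q) = Φ x y z s t q (φ s t q) :=
    fun Φ φ x y z s t q hm hm' => indicator_of_mem
      (mk_mem_prod (show (x, y, z) ∈ D.carrier from hm) (show (s, t, q) ∈ D.carrier from hm')) _
  have hrf : ∀ {x y z s t q : ℝ}, D.Mem x y z → D.Mem s t q → 0 ≤ r x y z * f s t q := by
    intro x y z s t q hm hm'
    simpa using (abs_nonneg _).trans (hLip x y z s t q 1 0 hm hm')
  have hFu := regularKernel_kernelExtend hF hu.1
  have hFh := regularKernel_kernelExtend hF hh.1
  have hGh := regularKernel_kernelExtend hG hh.1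
  have hK := (hFh.sub hGh).abs
  set w : ℝ × ℝ × ℝ → ℝ := fun p => |D.zeroExtend u p - D.zeroExtend h p|
  set R : ℝ × ℝ × ℝ → ℝ := fun p => |D.zeroExtend r p|
  set f' : ℝ × ℝ × ℝ → ℝ := fun p => |D.zeroExtend f p|
  set K : ℝ × ℝ × ℝ → ℝ := D.carrier.indicator fun p => ∫ p' in D.box p.1 p.2.1,
    |D.kernelExtend F h (p, p') - D.kernelExtend G h (p, p')| ∂D.deltaVolume with hKdef
  set A : ℝ × ℝ × ℝ → ℝ := fun p => |D.zeroExtend g p - D.zeroExtend v p| + K p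
  have hw : D.Regular w := ((regular_zeroExtend hu.1).sub (regular_zeroExtend hh.1)).abs
  have hR : D.Regular R := (regular_zeroExtend hr).abs
  have hf' : D.Regular f' := (regular_zeroExtend hf).abs
  have hA : D.Regular A :=
    ((regular_zeroExtend hg).sub (regular_zeroExtend hv)).abs.add hK.regular_integral
  have hA0 : ∀ p, 0 ≤ A p := fun p =>
    add_nonneg (abs_nonneg _) (indicator_nonneg (fun _ _ => integral_nonneg fun _ => abs_nonneg _) p)
  have hKeq : ∀ {x y z : ℝ}, D.Mem x y z → D.kBar F G h x y z = K (x, y, z) := by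
    intro x y z hm
    have hx : (x, y, z) ∈ D.carrier := hm
    rw [hKdef, indicator_of_mem hx, kBar]
    refine (hK.regular_right hx).tripleIntegral_eq hm.1 hm.2.1 fun s t q hm' => ?_
    rw [hke F h hm hm', hke G h hm hm']
  have hAeq : ∀ {x y z : ℝ}, D.Mem x y z → gBar g v x y z + D.kBar F G h x y z = A (x, y, z) := by
    intro x y z hm
    simp only [A, hKeq hm, gBar, hze g hm, hze v hm]
  -- Subtract the two equations and insert `F(p, p', h(p'))`.
  have hmain : ∀ p ∈ D.carrier,
      w p ≤ A p + R p * ∫ p' in D.box p.1 p.2.1, f' p' * w p' ∂D.deltaVolume := by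
    rintro ⟨x, y, z⟩ hp
    have hm : D.Mem x y z := hp
    have hiu := (hFu.regular_right hp).integrableOn hm.1.1 hm.2.1.1
    have hih := (hFh.regular_right hp).integrableOn hm.1.1 hm.2.1.1
    have hig := (hGh.regular_right hp).integrableOn hm.1.1 hm.2.1.1
    have hueq : u x y z = g x y z +
        ∫ p' in D.box x y, D.kernelExtend F u ((x, y, z), p') ∂D.deltaVolume := by
      rw [hu.2 x y z hm, (hFu.regular_right hp).tripleIntegral_eq hm.1 hm.2.1
        fun s t q hm' => (hke F u hm hm').symm]
    have hheq : h x y z = v x y z +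
        ∫ p' in D.box x y, D.kernelExtend G h ((x, y, z), p') ∂D.deltaVolume := by
      rw [hh.2 x y z hm, (hGh.regular_right hp).tripleIntegral_eq hm.1 hm.2.1
        fun s t q hm' => (hke G h hm hm').symm]
    have h1 := integral_sub hiu hih
    have h2 := integral_sub hih hig
    have h3 : |∫ p' in D.box x y, (D.kernelExtend F h ((x, y, z), p') -
        D.kernelExtend G h ((x, y, z), p')) ∂D.deltaVolume| ≤ K (x, y, z) := by
      rw [hKdef, indicator_of_mem hp]
      exact abs_integral_le_integral_abs
    have h4 : |∫ p' in D.box x y, (D.kernelExtend F u ((x, y, z), p') -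
        D.kernelExtend F h ((x, y, z), p')) ∂D.deltaVolume| ≤
        R (x, y, z) * ∫ p' in D.box x y, f' p' * w p' ∂D.deltaVolume := by
      rw [← integral_const_mul]
      refine abs_integral_le_integral_abs.trans ?_
      refine setIntegral_mono_on ((hFu.sub hFh).abs.regular_right hp |>.integrableOn hm.1.1 hm.2.1.1)
        (((hf'.mul hw).integrableOn hm.1.1 hm.2.1.1).const_mul _) (D.measurableSet_box x y) ?_
      rintro ⟨s, t, q⟩ -
      by_cases hm' : D.Mem s t q
      · rw [hke F u hm hm', hke F h hm hm']
        refine (hLip x y z s t q _ _ hm hm').trans_eq ?_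
        simp only [R, f', w, hze _ hm, hze _ hm']
        rw [← mul_assoc, ← abs_mul, abs_of_nonneg (hrf hm hm')]
      · rw [hFu.eq_zero _ _ hm', hFh.eq_zero _ _ hm', sub_zero, abs_zero]
        exact mul_nonneg (abs_nonneg _) (mul_nonneg (abs_nonneg _) (abs_nonneg _))
    have h5 : u x y z - h x y z = (g x y z - v x y z) +
        ((∫ p' in D.box x y, (D.kernelExtend F u ((x, y, z), p') -
          D.kernelExtend F h ((x, y, z), p')) ∂D.deltaVolume) +
        ∫ p' in D.box x y, (D.kernelExtend F h ((x, y, z), p') -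
          D.kernelExtend G h ((x, y, z), p')) ∂D.deltaVolume) := by
      rw [h1, h2, hueq, hheq]
      ring
    simp only [w, A, hze _ hm]
    rw [h5]
    refine (abs_add_le _ _).trans ?_
    have := (abs_add_le _ _).trans (add_le_add h4 h3)
    linarith
  intro x y z hm
  have hp : (x, y, z) ∈ D.carrier := hm
  have hfin := le_of_le_add_mul_integral hw hA hR hf' (fun _ => abs_nonneg _) hA0
    (fun _ => abs_nonneg _) (fun _ => abs_nonneg _) hmain hp
  simp only [w] at hfin
  rw [hze u hm, hze h hm] at hfin
  -- Only products of a value of `r` and a value of `f` occur, and these are nonnegative.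
  have hC : r x y z * D.C₄ f g v F G h x y =
      R (x, y, z) * ∫ p' in D.box x y, f' p' * A p' ∂D.deltaVolume := by
    rw [C₄, ((regular_zeroExtend hf).mul hA).tripleIntegral_eq hm.1 hm.2.1 fun s t q hm' => by
      rw [hAeq hm', hze f hm'], ← integral_const_mul, ← integral_const_mul]
    refine integral_congr_ae (Eventually.of_forall ?_)
    rintro ⟨s, t, q⟩
    by_cases hm' : D.Mem s t q
    · simp only [R, f', hze _ hm, hze _ hm']
      rw [← mul_assoc, ← mul_assoc, ← abs_mul, abs_of_nonneg (hrf hm hm')]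
    · simp only [hA.eq_zero (s, t, q) hm', mul_zero]
  have hQ : deltaExp D.T₁ (fun s => D.Q₂ r f s y) x D.x₀ =
      Real.exp (∫ s in Ico D.x₀ x, cylinder (graininess D.T₁ s)
        (∫ p' in D.rect y, f' (s, p') * R (s, p') ∂D.deltaVolume₂) ∂deltaMeasure D.T₁) := by
    rw [deltaExp, deltaIntegral_of_le hm.1.2]
    congr 1
    refine setIntegral_deltaMeasure_congr D.isTimeScale₁.isClosed fun s hs hsI => ?_
    rw [Q₂, (hf'.mul hR).setIntegral_rect_eq ⟨hs, hsI.1⟩ hm.2.1]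
    intro t q hm'
    simp only [R, f', hze _ hm']
    rw [← abs_mul, abs_of_nonneg (by rw [mul_comm]; exact hrf hm' hm')]
  rw [hAeq hm, hC, hQ]
  rw [← mul_assoc] at hfin
  exact hfin

end
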